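/- Fix $n\ge 1$. Matrices. An alternating sign matrix (ASM) of order $n$ is an $n\times n$ matrix $A$ with entries in $\{-1,0,1\}$, all row and column sums equal to $1$, and nonzero entries alternating in sign along every row and column. Its height function is $H_A(i,j)=i+j-2\sum_{i'\le i,\,j'\le j}A_{i',j'}$ for $0\le i,j\le n$. Ordered by entrywise comparison of height functions, the ASMs of order $n$ form a distributive lattice $\mathbf{ASM}_n$. A pair $(i,j)$ with $0\le i,j\le n$ is an ascent of $A$ if there is an ASM $A'$ with $H_{A'}(i,j)=H_A(i,j)+2$ and $H_{A'}=H_A$ at all other positions. The permutation matrix $P_\sigma$ has entries $1$ exactly at the positions $(i,\sigma_i)$. A permutation is covexillary if it avoids the pattern $3412$. Posets. Let $\mathcal T_n$ be the set of $x\in\mathbb N^4$ with $x_1+x_2+x_3+x_4=n-2$, ordered by $x\le x'$ iff $x_1\ge x_1'$, $x_2\le x_2'$, $x_3\le x_3'$, $x_4\ge x_4'$. Let $\mathcal D_n$ be the set of $y\in\mathbb N^3$ with $y_1+y_2+y_3=n-2$, ordered by $y\le z$ iff $y_1+y_2\le z_1+z_2$ and $y_2+y_3\le z_2+z_3$. Let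 $\pi:\mathcal T_n\to\mathcal D_n$ be $\pi(x)=(x_1,x_2+x_3,x_4)$. For $x\in\mathcal T_n$ let $m(x)$ be the meet-irreducible ASM $$m(x)=\begin{pmatrix}0&0&0&\bar I_{x_2}\\0&\bar I_{x_1+1}&0&0\\0&0&\bar I_{x_4+1}&0\\\bar I_{x_3}&0&0&0\end{pmatrix},$$ where $\bar I_k$ is the $k\times k$ matrix with ones on the anti-diagonal and zeros elsewhere. For an ASM $A$, let $m(A)$ be the antichain of minimal elements of $\{x\in\mathcal T_n : A\le m(x)\}$. The map $\varepsilon_A:\pi(m(A))\to\mathbb Z$ is defined by $\varepsilon_A(\pi(x))=x_3-x_2$ for $x\in m(A)$; it may fail to be well-defined. Depth antichains, depth triangles, walls, congruences. - A depth antichain of $\mathcal D_n$ is a map $\varepsilon:S\to\mathbb Z$ on a (possibly empty) antichain $S$ of $\mathcal D_n$ such that $-y_2\le\varepsilon(y)\le y_2$, $\varepsilon(y)\equiv y_2 \pmod 2$, and $|\varepsilon(y)-\varepsilon(z)|\le|y_1-z_1|+|y_3-z_3|$ for all $y,z\in S$. - A depth triangle of order $n$ is a map $\delta:\mathcal D_n\to\mathbb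 Z$ with $\delta(y)=0$ whenever $y_2=0$, and $|\delta(y_1,y_2,y_3)-\delta(y_1,y_2-1,y_3+1)|=1=|\delta(y_1,y_2,y_3)-\delta(y_1+1,y_2-1,y_3)|$ whenever $y_2\ge1$. - A wall of order $n$ is an induced subposet of $\mathcal T_n$ isomorphic to $\mathcal D_n$. - A catalan congruence is a lattice congruence of $\mathbf{ASM}_n$ whose quotient is isomorphic to the Stanley lattice of Dyck paths of semilength $n$, ordered by $P\le Q$ iff $P$ stays weakly below $Q$. Theorem. For an ASM $A$ of order $n$, the following are equivalent: 1. $A$ is the permutation matrix of a covexillary permutation; 2. $A$ does not have two ascents $(i,j)$ and $(k,\ell)$ with $i<k$ and $j>\ell$; 3. $\varepsilon_A$ is well-defined and is a depth antichain of $\mathcal D_n$; 4. $\varepsilon_A$ is well-defined and extends to a depth triangle of order $n$; 5. there is a wall of order $n$ containing $m(A)$; 6. there is a catalan congruence of $\mathbf{ASM}_n$ such that $A$ is the maximum of its class. Moreover, the covexillary permutations of $[n]$, the depth antichains of $\mathcal D_n$, and the ASMs that are the maximum of their class for some catalan congruence of $\mathbf{ASM}_n$ are in bijection. Explicitly, $\sigma\mapsto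 P_\sigma$ is a bijection from the first family to the third. A bijection from the second family to the third sends $\varepsilon:S\to\mathbb Z$ to the meet $A$ in $\mathbf{ASM}_n$ of all $m(x)$ with $x\in\mathcal T_n$, $\pi(x)\in S$ and $x_3-x_2=\varepsilon(\pi(x))$; it satisfies $\varepsilon_A=\varepsilon$. -/

import Mathlib

namespace AlternatingSign

/-! ### Alternating vectors and their partial sums -/

/-- Entries in `{-1, 0, 1}`, sum `1`, and consecutive nonzero entries have opposite signs. -/
def IsAlternating {n : ℕ} (v : Fin n → ℤ) : Prop :=
  (∀ i, v i = -1 ∨ v i = 0 ∨ v i = 1) ∧ ∑ i, v i = 1 ∧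
    ∀ i j, i < j → v i ≠ 0 → v j ≠ 0 → (∀ k, i < k → k < j → v k = 0) → v j = -v i

/-- The sum of the first `k` entries of `v`. -/
def partialSum {n : ℕ} (v : Fin n → ℤ) (k : ℕ) : ℤ := ∑ i : Fin n, if i.val < k then v i else 0

theorem partialSum_zero {n : ℕ} (v : Fin n → ℤ) : partialSum v 0 = 0 := by
  simp [partialSum]

theorem partialSum_full {n : ℕ} (v : Fin n → ℤ) : partialSum v n = ∑ i, v i := by
  simp [partialSum]

theorem partialSum_succ {n : ℕ} (v : Fin n → ℤ) (k : Fin n) :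
    partialSum v (k.val + 1) = partialSum v k.val + v k := by
  have h : v k = ∑ i : Fin n, if i = k then v i else 0 := by simp
  rw [partialSum, partialSum, h, ← Finset.sum_add_distrib]
  refine Finset.sum_congr rfl fun i _ => ?_
  by_cases h1 : i = k
  · subst h1; simp
  · have : i.val ≠ k.val := fun h => h1 (Fin.ext h)
    by_cases h2 : i.val < k.val
    · simp [h1, h2, Nat.lt_succ_of_lt h2]
    · have h3 : ¬ i.val < k.val + 1 := by omega
      simp [h1, h2, h3]

theorem partialSum_congr_of_zero {n : ℕ} (v : Fin n → ℤ) (a b : ℕ) (hab : a ≤ b) (hb : b ≤ n)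
    (h : ∀ k : Fin n, a ≤ k.val → k.val < b → v k = 0) : partialSum v b = partialSum v a := by
  induction b, hab using Nat.le_induction with
  | base => rfl
  | succ b hab ih =>
    have h1 := partialSum_succ v ⟨b, by omega⟩
    simp only at h1
    rw [h1, h ⟨b, by omega⟩ hab (by simp),
      ih (by omega) (fun k hk hk' => h k hk (by omega)), add_zero]

theorem IsAlternating.interval {n : ℕ} {v : Fin n → ℤ} (hv : IsAlternating v) (a b : ℕ)
    (hab : a ≤ b) (hb : b ≤ n) :
    ((∀ k : Fin n, a ≤ k.val → k.val < b → v k = 0) ∧ partialSum v b - partialSum v a = 0) ∨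
    ∃ p : Fin n, p.val < b ∧ v p ≠ 0 ∧ (∀ k : Fin n, p < k → k.val < b → v k = 0) ∧
      (partialSum v b - partialSum v a = v p ∨ partialSum v b - partialSum v a = 0) := by
  induction b, hab using Nat.le_induction with
  | base => left; exact ⟨fun k h1 h2 => by omega, by simp⟩
  | succ b hab ih =>
    have h1 := partialSum_succ v ⟨b, by omega⟩
    simp only at h1
    by_cases h0 : v ⟨b, by omega⟩ = 0
    · rcases ih (by omega) with ⟨hz, hs⟩ | ⟨p, hp, hp0, hz, hs⟩
      · left
        refine ⟨fun k hk hk' => ?_, by omega⟩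
        by_cases hkb : k.val = b
        · have : k = ⟨b, by omega⟩ := Fin.ext hkb
          rw [this, h0]
        · exact hz k hk (by omega)
      · right
        refine ⟨p, by omega, hp0, fun k hk hk' => ?_, by omega⟩
        by_cases hkb : k.val = b
        · have : k = ⟨b, by omega⟩ := Fin.ext hkb
          rw [this, h0]
        · exact hz k hk (by omega)
    · right
      refine ⟨⟨b, by omega⟩, by simp, h0, fun k hk hk' => ?_, ?_⟩
      · have : b < k.val := hk
        omega
      · rcases ih (by omega) with ⟨hz, hs⟩ | ⟨p, hp, hp0, hz, hs⟩
        · left; omega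
        · have := hv.2.2 p ⟨b, by omega⟩ hp hp0 h0 (fun k hk hk' => hz k hk hk')
          omega

theorem IsAlternating.partialSum_mem {n : ℕ} {v : Fin n → ℤ} (hv : IsAlternating v) (k : ℕ)
    (hk : k ≤ n) : partialSum v k = 0 ∨ partialSum v k = 1 := by
  have h0 := partialSum_zero v
  have hn := partialSum_full v
  rw [hv.2.1] at hn
  have key : ∀ a b, a ≤ b → b ≤ n → partialSum v b - partialSum v a ≤ 1 := by
    intro a b hab hb
    rcases hv.interval a b hab hb with ⟨_, h⟩ | ⟨p, _, _, _, h⟩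
    · omega
    · have := hv.1 p
      omega
  have h1 := key 0 k (Nat.zero_le _) hk
  have h2 := key k n hk le_rfl
  omega

theorem isAlternating_of_partialSum {n : ℕ} {v : Fin n → ℤ} (hn : partialSum v n = 1)
    (h : ∀ k ≤ n, partialSum v k = 0 ∨ partialSum v k = 1) : IsAlternating v := by
  refine ⟨fun i => ?_, by rw [← partialSum_full, hn], fun i j hij hi hj hz => ?_⟩
  · have h1 := partialSum_succ v i
    have h2 := h i.val (by omega)
    have h3 := h (i.val + 1) (by omega)
    omega
  · have h1 := partialSum_succ v i
    have h2 := partialSum_succ v j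
    have a1 := h i.val (by omega)
    have a2 := h (i.val + 1) (by omega)
    have a3 := h j.val (by omega)
    have a4 := h (j.val + 1) (by omega)
    have h5 := partialSum_congr_of_zero v (i.val + 1) j.val hij (by omega)
      (fun k hk hk' => hz k hk hk')
    omega

theorem isAlternating_single {n : ℕ} (p : Fin n) :
    IsAlternating (fun i : Fin n => if i = p then (1 : ℤ) else 0) := by
  refine ⟨fun i => ?_, by simp, fun i j hij hi hj _ => ?_⟩
  · by_cases h : i = p <;> simp [h]
  · have h1 : i = p := by by_contra h; simp [h] at hi
    have h2 : j = p := by by_contra h; simp [h] at hj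
    exact absurd (h1.trans h2.symm) (ne_of_lt hij)

/-! ### Alternating sign matrices and height function matrices -/

/-- Alternating sign matrices of order `n`; rows and columns are indexed by `0, …, n - 1`. -/
@[ext]
structure ASM (n : ℕ) where
  toMatrix : Matrix (Fin n) (Fin n) ℤ
  row : ∀ i, IsAlternating fun j => toMatrix i j
  col : ∀ j, IsAlternating fun i => toMatrix i j

/-- Height function matrices of order `n`; rows and columns are indexed by `0, …, n`. -/
@[ext]
structure HFM (n : ℕ) where
  toFun : Fin (n + 1) → Fin (n + 1) → ℤ
  first_row : ∀ j, toFun 0 j = (j.val : ℤ)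
  first_col : ∀ i, toFun i 0 = (i.val : ℤ)
  last_row : ∀ j, toFun (Fin.last n) j = (n : ℤ) - (j.val : ℤ)
  last_col : ∀ i, toFun i (Fin.last n) = (n : ℤ) - (i.val : ℤ)
  row_step : ∀ (i : Fin (n + 1)) (j : Fin n), |toFun i j.succ - toFun i j.castSucc| = 1
  col_step : ∀ (i : Fin n) (j : Fin (n + 1)), |toFun i.succ j - toFun i.castSucc j| = 1

theorem HFM.parity {n : ℕ} (H : HFM n) (i j : Fin (n + 1)) :
    Even (H.toFun i j - (i.val : ℤ) - (j.val : ℤ)) := by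
  induction j using Fin.induction with
  | zero => simp [H.first_col]
  | succ j ih =>
    have h := H.row_step i j
    rw [Int.even_iff] at ih ⊢
    simp only [Fin.val_succ, Fin.val_castSucc] at *
    push_cast
    rcases (abs_eq (by norm_num : (0 : ℤ) ≤ 1)).1 h with h | h <;> omega

theorem abs_max_sub_max {a a' b b' : ℤ} (ha : |a - a'| = 1) (hb : |b - b'| = 1)
    (hab : Even (a - b)) : |max a b - max a' b'| = 1 := by
  rw [Int.even_iff] at hab
  rw [abs_eq (by norm_num)] at *
  omega

theorem abs_min_sub_min {a a' b b' : ℤ} (ha : |a - a'| = 1) (hb : |b - b'| = 1)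
    (hab : Even (a - b)) : |min a b - min a' b'| = 1 := by
  rw [Int.even_iff] at hab
  rw [abs_eq (by norm_num)] at *
  omega

theorem HFM.even_sub {n : ℕ} (H K : HFM n) (i j : Fin (n + 1)) :
    Even (H.toFun i j - K.toFun i j) := by
  have h1 := H.parity i j
  have h2 := K.parity i j
  rw [Int.even_iff] at *
  omega

/-- The lattice of height function matrices, ordered entrywise. -/
instance (n : ℕ) : Lattice (HFM n) where
  le H K := ∀ i j, H.toFun i j ≤ K.toFun i j
  le_refl H i j := le_rfl
  le_trans H K L h1 h2 i j := (h1 i j).trans (h2 i j)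
  le_antisymm H K h1 h2 := HFM.ext (funext fun i => funext fun j => le_antisymm (h1 i j) (h2 i j))
  sup H K :=
    { toFun := fun i j => max (H.toFun i j) (K.toFun i j)
      first_row := fun j => by simp [H.first_row, K.first_row]
      first_col := fun j => by simp [H.first_col, K.first_col]
      last_row := fun j => by simp [H.last_row, K.last_row]
      last_col := fun j => by simp [H.last_col, K.last_col]
      row_step := fun i j => abs_max_sub_max (H.row_step i j) (K.row_step i j) (H.even_sub K _ _)
      col_step := fun i j => abs_max_sub_max (H.col_step i j) (K.col_step i j) (H.even_sub K _ _) }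
  inf H K :=
    { toFun := fun i j => min (H.toFun i j) (K.toFun i j)
      first_row := fun j => by simp [H.first_row, K.first_row]
      first_col := fun j => by simp [H.first_col, K.first_col]
      last_row := fun j => by simp [H.last_row, K.last_row]
      last_col := fun j => by simp [H.last_col, K.last_col]
      row_step := fun i j => abs_min_sub_min (H.row_step i j) (K.row_step i j) (H.even_sub K _ _)
      col_step := fun i j => abs_min_sub_min (H.col_step i j) (K.col_step i j) (H.even_sub K _ _) }
  le_sup_left H K i j := le_max_left _ _
  le_sup_right H K i j := le_max_right _ _
  sup_le H K L h1 h2 i j := max_le (h1 i j) (h2 i j)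
  inf_le_left H K i j := min_le_left _ _
  inf_le_right H K i j := min_le_right _ _
  le_inf H K L h1 h2 i j := le_min (h1 i j) (h2 i j)

/-- The corner sum matrix: `cornerSum M i j` is the sum of the entries of `M` in the first `i` rows
and the first `j` columns. -/
def cornerSum {n : ℕ} (M : Matrix (Fin n) (Fin n) ℤ) (i j : ℕ) : ℤ :=
  ∑ i' : Fin n, ∑ j' : Fin n, if i'.val < i ∧ j'.val < j then M i' j' else 0

theorem cornerSum_eq_row {n : ℕ} (M : Matrix (Fin n) (Fin n) ℤ) (i j : ℕ) :
    cornerSum M i j = partialSum (fun i' => partialSum (fun j' => M i' j') j) i := by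
  unfold cornerSum partialSum
  refine Finset.sum_congr rfl fun i' _ => ?_
  by_cases h : i'.val < i <;> simp [h]

theorem cornerSum_eq_col {n : ℕ} (M : Matrix (Fin n) (Fin n) ℤ) (i j : ℕ) :
    cornerSum M i j = partialSum (fun j' => partialSum (fun i' => M i' j') i) j := by
  unfold cornerSum partialSum
  rw [Finset.sum_comm]
  refine Finset.sum_congr rfl fun j' _ => ?_
  by_cases h : j'.val < j <;> simp [h]

theorem cornerSum_succ_row {n : ℕ} (M : Matrix (Fin n) (Fin n) ℤ) (i : Fin n) (j : ℕ) :
    cornerSum M (i.val + 1) j = cornerSum M i.val j + partialSum (fun j' => M i j') j := by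
  rw [cornerSum_eq_row, cornerSum_eq_row, partialSum_succ]

theorem cornerSum_succ_col {n : ℕ} (M : Matrix (Fin n) (Fin n) ℤ) (i : ℕ) (j : Fin n) :
    cornerSum M i (j.val + 1) = cornerSum M i j.val + partialSum (fun i' => M i' j) i := by
  rw [cornerSum_eq_col, cornerSum_eq_col, partialSum_succ]

theorem partialSum_one {n : ℕ} (k : ℕ) (hk : k ≤ n) :
    partialSum (fun _ : Fin n => (1 : ℤ)) k = (k : ℤ) := by
  induction k with
  | zero => simp [partialSum_zero]
  | succ k ih =>
    have := partialSum_succ (fun _ : Fin n => (1 : ℤ)) ⟨k, by omega⟩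
    simp only at this
    rw [this, ih (by omega)]
    push_cast
    ring

/-- The height function matrix `H i j = i + j - 2 C i j` of an alternating sign matrix with corner
sum matrix `C`. -/
def ASM.toHFM {n : ℕ} (A : ASM n) : HFM n where
  toFun i j := (i.val : ℤ) + (j.val : ℤ) - 2 * cornerSum A.toMatrix i.val j.val
  first_row j := by simp [cornerSum_eq_row, partialSum_zero]
  first_col i := by simp [cornerSum_eq_col, partialSum_zero]
  last_row j := by
    have h : (fun j' => partialSum (fun i' => A.toMatrix i' j') n) = fun _ => (1 : ℤ) :=
      funext fun j' => by rw [partialSum_full]; exact (A.col j').2.1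
    rw [Fin.val_last, cornerSum_eq_col, h, partialSum_one _ (by omega)]
    ring
  last_col i := by
    have h : (fun i' => partialSum (fun j' => A.toMatrix i' j') n) = fun _ => (1 : ℤ) :=
      funext fun i' => by rw [partialSum_full]; exact (A.row i').2.1
    rw [Fin.val_last, cornerSum_eq_row, h, partialSum_one _ (by omega)]
    ring
  row_step i j := by
    simp only [Fin.val_succ, Fin.val_castSucc, cornerSum_succ_col]
    push_cast
    rw [abs_eq (by norm_num)]
    have := (A.col j).partialSum_mem i.val (by omega)
    omega
  col_step i j := by
    simp only [Fin.val_succ, Fin.val_castSucc, cornerSum_succ_row]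
    push_cast
    rw [abs_eq (by norm_num)]
    have := (A.row i).partialSum_mem j.val (by omega)
    omega

theorem ASM.toHFM_injective {n : ℕ} : Function.Injective (ASM.toHFM (n := n)) := by
  intro A B h
  have hC : ∀ i j : ℕ, i ≤ n → j ≤ n → cornerSum A.toMatrix i j = cornerSum B.toMatrix i j := by
    intro i j hi hj
    have := congrFun (congrFun (congrArg HFM.toFun h) ⟨i, by omega⟩) ⟨j, by omega⟩
    simp only [ASM.toHFM] at this
    omega
  apply ASM.ext
  ext i j
  have e : ∀ M : Matrix (Fin n) (Fin n) ℤ, M i j = cornerSum M (i.val + 1) (j.val + 1)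
      - cornerSum M i.val (j.val + 1) - (cornerSum M (i.val + 1) j.val - cornerSum M i.val j.val) := by
    intro M
    rw [cornerSum_succ_row, cornerSum_succ_row, partialSum_succ]
    ring
  have e1 := e A.toMatrix
  have e2 := e B.toMatrix
  rw [e1, e2, hC _ _ (by omega) (by omega), hC _ _ (by omega) (by omega),
    hC _ _ (by omega) (by omega), hC _ _ (by omega) (by omega)]

/-- The matrix of half second differences of a height function matrix. -/
def HFM.mat {n : ℕ} (H : HFM n) : Matrix (Fin n) (Fin n) ℤ := fun i j =>
  (H.toFun i.castSucc j.succ + H.toFun i.succ j.castSucc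
    - H.toFun i.succ j.succ - H.toFun i.castSucc j.castSucc) / 2

theorem HFM.two_mul_mat {n : ℕ} (H : HFM n) (i j : Fin n) :
    2 * H.mat i j = H.toFun i.castSucc j.succ + H.toFun i.succ j.castSucc
      - H.toFun i.succ j.succ - H.toFun i.castSucc j.castSucc := by
  have h1 := H.row_step i.castSucc j
  have h2 := H.row_step i.succ j
  rw [abs_eq (by norm_num)] at h1 h2
  unfold HFM.mat
  omega

theorem HFM.row_partialSum {n : ℕ} (H : HFM n) (i : Fin n) (j : Fin (n + 1)) :
    2 * partialSum (fun j' => H.mat i j') j.val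
      = 1 + H.toFun i.castSucc j - H.toFun i.succ j := by
  induction j using Fin.induction with
  | zero => simp [partialSum_zero, H.first_col]; ring
  | succ j ih =>
    rw [Fin.val_succ, partialSum_succ]
    rw [Fin.val_castSucc] at ih
    have := H.two_mul_mat i j
    omega

theorem HFM.col_partialSum {n : ℕ} (H : HFM n) (i : Fin (n + 1)) (j : Fin n) :
    2 * partialSum (fun i' => H.mat i' j) i.val
      = 1 + H.toFun i j.castSucc - H.toFun i j.succ := by
  induction i using Fin.induction with
  | zero => simp [partialSum_zero, H.first_row]; ring
  | succ i ih =>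
    rw [Fin.val_succ, partialSum_succ]
    rw [Fin.val_castSucc] at ih
    have := H.two_mul_mat i j
    omega

theorem ASM.toHFM_surjective {n : ℕ} : Function.Surjective (ASM.toHFM (n := n)) := by
  intro H
  refine ⟨⟨H.mat, fun i => isAlternating_of_partialSum ?_ fun k hk => ?_,
    fun j => isAlternating_of_partialSum ?_ fun k hk => ?_⟩, ?_⟩
  · have := H.row_partialSum i (Fin.last n)
    simp only [H.last_col, Fin.val_last, Fin.val_castSucc, Fin.val_succ] at this
    push_cast at this
    omega
  · have h1 := H.row_partialSum i ⟨k, by omega⟩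
    have h2 := H.col_step i ⟨k, by omega⟩
    rw [abs_eq (by norm_num)] at h2
    simp only at h1
    omega
  · have := H.col_partialSum (Fin.last n) j
    simp only [H.last_row, Fin.val_last, Fin.val_castSucc, Fin.val_succ] at this
    push_cast at this
    omega
  · have h1 := H.col_partialSum ⟨k, by omega⟩ j
    have h2 := H.row_step ⟨k, by omega⟩ j
    rw [abs_eq (by norm_num)] at h2
    simp only at h1
    omega
  · apply HFM.ext
    funext i j
    simp only [ASM.toHFM]
    induction i using Fin.induction with
    | zero => simp [cornerSum_eq_row, partialSum_zero, H.first_row]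
    | succ i ih =>
      rw [Fin.val_succ, cornerSum_succ_row]
      rw [Fin.val_castSucc] at ih
      have := H.row_partialSum i j
      push_cast
      omega

/-- The bijection between alternating sign matrices and height function matrices. -/
noncomputable def asmEquivHFM (n : ℕ) : ASM n ≃ HFM n :=
  Equiv.ofBijective ASM.toHFM ⟨ASM.toHFM_injective, ASM.toHFM_surjective⟩

/-- The lattice of alternating sign matrices, transported from height function matrices. -/
noncomputable instance (n : ℕ) : Lattice (ASM n) where
  le A B := A.toHFM ≤ B.toHFM
  le_refl A := le_refl A.toHFM
  le_trans _ _ _ h1 h2 := le_trans h1 h2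
  le_antisymm _ _ h1 h2 := ASM.toHFM_injective (le_antisymm h1 h2)
  sup A B := (asmEquivHFM n).symm (asmEquivHFM n A ⊔ asmEquivHFM n B)
  inf A B := (asmEquivHFM n).symm (asmEquivHFM n A ⊓ asmEquivHFM n B)
  le_sup_left A B := by
    change asmEquivHFM n A ≤ asmEquivHFM n _
    simp
  le_sup_right A B := by
    change asmEquivHFM n B ≤ asmEquivHFM n _
    simp
  sup_le A B D h1 h2 := by
    change asmEquivHFM n _ ≤ asmEquivHFM n D
    rw [Equiv.apply_symm_apply]
    exact sup_le h1 h2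
  inf_le_left A B := by
    change asmEquivHFM n _ ≤ asmEquivHFM n A
    simp
  inf_le_right A B := by
    change asmEquivHFM n _ ≤ asmEquivHFM n B
    simp
  le_inf A B D h1 h2 := by
    change asmEquivHFM n A ≤ asmEquivHFM n _
    rw [Equiv.apply_symm_apply]
    exact le_inf h1 h2

/-- `(i, j)` is an ascent of `A`: raising the height function of `A` by `2` at the single position
`(i, j)` gives the height function of another alternating sign matrix. -/
def IsAscent {n : ℕ} (A : ASM n) (i j : Fin (n + 1)) : Prop :=
  ∃ A' : ASM n, A'.toHFM.toFun i j = A.toHFM.toFun i j + 2 ∧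
    ∀ k l, (k, l) ≠ (i, j) → A'.toHFM.toFun k l = A.toHFM.toFun k l

/-! ### Permutations -/

/-- The permutation matrix of `σ`, with entry `1` at the positions `(i, σ i)`. -/
def permASM {n : ℕ} (σ : Equiv.Perm (Fin n)) : ASM n where
  toMatrix := σ.permMatrix ℤ
  row i := by
    convert isAlternating_single (σ i) using 2 with j
    simp [Equiv.Perm.permMatrix, PEquiv.toMatrix_apply, eq_comm]
  col j := by
    convert isAlternating_single (σ.symm j) using 2 with i
    simp [Equiv.Perm.permMatrix, PEquiv.toMatrix_apply, Equiv.eq_symm_apply]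

/-- Covexillary permutations, i.e. those that avoid the pattern `3412`. -/
def IsCovexillary {n : ℕ} (σ : Equiv.Perm (Fin n)) : Prop :=
  ¬ ∃ a b c d : Fin n, a < b ∧ b < c ∧ c < d ∧ σ c < σ d ∧ σ d < σ a ∧ σ a < σ b

/-! ### The tetrahedral and the triangular posets -/

/-- The points of the tetrahedron poset of order `n`, i.e. `x₁ + x₂ + x₃ + x₄ = n - 2`. -/
@[ext]
structure Tetra (n : ℕ) where
  x₁ : ℕ
  x₂ : ℕ
  x₃ : ℕ
  x₄ : ℕ
  sum_eq : x₁ + x₂ + x₃ + x₄ + 2 = n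

instance (n : ℕ) : PartialOrder (Tetra n) where
  le x y := y.x₁ ≤ x.x₁ ∧ x.x₂ ≤ y.x₂ ∧ x.x₃ ≤ y.x₃ ∧ y.x₄ ≤ x.x₄
  le_refl x := ⟨le_rfl, le_rfl, le_rfl, le_rfl⟩
  le_trans x y z h1 h2 := ⟨h2.1.trans h1.1, h1.2.1.trans h2.2.1, h1.2.2.1.trans h2.2.2.1,
    h2.2.2.2.trans h1.2.2.2⟩
  le_antisymm x y h1 h2 := Tetra.ext (le_antisymm h2.1 h1.1) (le_antisymm h1.2.1 h2.2.1)
    (le_antisymm h1.2.2.1 h2.2.2.1) (le_antisymm h2.2.2.2 h1.2.2.2)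

/-- The points of the triangular poset of order `n`, i.e. `y₁ + y₂ + y₃ = n - 2`. -/
@[ext]
structure Tri (n : ℕ) where
  y₁ : ℕ
  y₂ : ℕ
  y₃ : ℕ
  sum_eq : y₁ + y₂ + y₃ + 2 = n

instance (n : ℕ) : PartialOrder (Tri n) where
  le y z := y.y₁ + y.y₂ ≤ z.y₁ + z.y₂ ∧ y.y₂ + y.y₃ ≤ z.y₂ + z.y₃
  le_refl y := ⟨le_rfl, le_rfl⟩
  le_trans x y z h1 h2 := ⟨h1.1.trans h2.1, h1.2.trans h2.2⟩
  le_antisymm y z h1 h2 := by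
    have a := h1.1
    have b := h1.2
    have c := h2.1
    have d := h2.2
    have e := y.sum_eq
    have f := z.sum_eq
    ext <;> omega

/-- The horizontal projection of the tetrahedron to the triangle. -/
def Tetra.proj {n : ℕ} (x : Tetra n) : Tri n where
  y₁ := x.x₁
  y₂ := x.x₂ + x.x₃
  y₃ := x.x₄
  sum_eq := by have := x.sum_eq; omega

/-- The depth `x₃ - x₂` of a point of the tetrahedron. -/
def Tetra.depth {n : ℕ} (x : Tetra n) : ℤ := (x.x₃ : ℤ) - (x.x₂ : ℤ)

/-- The column (counted from `0`) of the entry `1` in row `i` of the block matrix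
`[0, 0, 0, Ī_{x₂}; 0, Ī_{x₁+1}, 0, 0; 0, 0, Ī_{x₄+1}, 0; Ī_{x₃}, 0, 0, 0]`,
where `Ī_k` is the anti-identity matrix of size `k` and `n = x₁ + x₂ + x₃ + x₄ + 2`. -/
def antiColumn (x₁ x₂ x₃ x₄ i : ℕ) : ℕ :=
  if i < x₂ then x₁ + x₂ + x₃ + x₄ + 1 - i
  else if i < x₂ + (x₁ + 1) then x₁ + x₂ + x₃ - i
  else if i < x₂ + (x₁ + 1) + (x₄ + 1) then (x₁ + x₂ + x₃ + x₄ + 2) + x₁ - i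
  else x₁ + x₂ + x₃ + x₄ + 1 - i

/-- The anti-bigrassmannian permutation of a point of the tetrahedron. -/
def antiPerm {n : ℕ} (x : Tetra n) : Equiv.Perm (Fin n) where
  toFun i := ⟨antiColumn x.x₁ x.x₂ x.x₃ x.x₄ i.val, by
    have := x.sum_eq
    have := i.isLt
    unfold antiColumn
    split_ifs <;> omega⟩
  invFun j := ⟨antiColumn x.x₁ x.x₃ x.x₂ x.x₄ j.val, by
    have := x.sum_eq
    have := j.isLt
    unfold antiColumn
    split_ifs <;> omega⟩
  left_inv i := by
    have := x.sum_eq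
    have := i.isLt
    apply Fin.ext
    simp only [antiColumn]
    split_ifs <;> omega
  right_inv j := by
    have := x.sum_eq
    have := j.isLt
    apply Fin.ext
    simp only [antiColumn]
    split_ifs <;> omega

/-- The meet irreducible alternating sign matrix associated with a point of the tetrahedron. -/
def meetIrr {n : ℕ} (x : Tetra n) : ASM n := permASM (antiPerm x)

/-- The upper set of the tetrahedron corresponding to `A`. -/
def upperOf {n : ℕ} (A : ASM n) : Set (Tetra n) := {x | A ≤ meetIrr x}

/-- The antichain `m(A)` of minimal elements of the upper set corresponding to `A`. -/
def meetAntichain {n : ℕ} (A : ASM n) : Set (Tetra n) := {x | Minimal (· ∈ upperOf A) x}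

/-- The projection of `m(A)` to the triangle. -/
def projAntichain {n : ℕ} (A : ASM n) : Set (Tri n) := Tetra.proj '' meetAntichain A

/-- `ε` is the map `ε_A` on the projection of `m(A)`; such a map exists (and is then unique) exactly
when `ε_A` is well-defined. -/
def IsProjectedDepth {n : ℕ} (A : ASM n) (ε : projAntichain A → ℤ) : Prop :=
  ∀ (x : Tetra n) (hx : x ∈ meetAntichain A), ε ⟨x.proj, Set.mem_image_of_mem _ hx⟩ = x.depth

/-! ### Depth triangles, depth antichains and walls -/

def IsDepthTriangle {n : ℕ} (δ : Tri n → ℤ) : Prop :=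
  (∀ y : Tri n, y.y₂ = 0 → δ y = 0) ∧
  (∀ y z : Tri n, z.y₁ = y.y₁ → z.y₂ + 1 = y.y₂ → z.y₃ = y.y₃ + 1 → |δ y - δ z| = 1) ∧
  (∀ y z : Tri n, z.y₁ = y.y₁ + 1 → z.y₂ + 1 = y.y₂ → z.y₃ = y.y₃ → |δ y - δ z| = 1)

def IsDepthAntichain {n : ℕ} (S : Set (Tri n)) (ε : S → ℤ) : Prop :=
  IsAntichain (· ≤ ·) S ∧
  (∀ y : S, -(y.val.y₂ : ℤ) ≤ ε y ∧ ε y ≤ (y.val.y₂ : ℤ) ∧ ε y ≡ (y.val.y₂ : ℤ) [ZMOD 2]) ∧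
  (∀ y z : S, |ε y - ε z| ≤
    |(y.val.y₁ : ℤ) - (z.val.y₁ : ℤ)| + |(y.val.y₃ : ℤ) - (z.val.y₃ : ℤ)|)

/-- The type of depth antichains of the triangular poset of order `n`. -/
structure DepthAntichain (n : ℕ) where
  carrier : Set (Tri n)
  toFun : carrier → ℤ
  isDepthAntichain : IsDepthAntichain carrier toFun

/-- A wall is an induced subposet of the tetrahedron isomorphic to the triangular poset. -/
def IsWall {n : ℕ} (W : Set (Tetra n)) : Prop := Nonempty (W ≃o Tri n)

/-! ### Dyck paths and catalan congruences -/

/-- Dyck paths of semilength `n`. -/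
def DyckPath (n : ℕ) : Type := {w : DyckWord // w.semilength = n}

/-- The height of a Dyck path after `k` steps. -/
def DyckPath.height {n : ℕ} (P : DyckPath n) (k : ℕ) : ℤ :=
  ((P.val.toList.take k).count DyckStep.U : ℤ) - ((P.val.toList.take k).count DyckStep.D : ℤ)

/-- The order of the Stanley lattice: `P` stays weakly below `Q`. -/
def stanleyLE {n : ℕ} (P Q : DyckPath n) : Prop := ∀ k, P.height k ≤ Q.height k

/-- The order on the quotient of a lattice by a congruence. -/
def quotLE {L : Type*} [Lattice L] (c : LatticeCon L) (X Y : Quotient c.toSetoid) : Prop :=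
  ∃ x y : L, Quotient.mk c.toSetoid x = X ∧ Quotient.mk c.toSetoid y = Y ∧ x ≤ y

/-- Catalan congruences: the quotient is isomorphic to the Stanley lattice. -/
def IsCatalan {n : ℕ} (c : LatticeCon (ASM n)) : Prop :=
  Nonempty (quotLE c ≃r (stanleyLE : DyckPath n → DyckPath n → Prop))

/-- `A` is the maximum of its class for some catalan congruence. -/
def IsCatalanMax {n : ℕ} (A : ASM n) : Prop :=
  ∃ c : LatticeCon (ASM n), IsCatalan c ∧ IsGreatest {B | c.r A B} A

end AlternatingSign

open AlternatingSign

/-!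
The proof works in Birkhoff's representation. A point `x` of the tetrahedron is a triple (row,
column, height), and `meetIrr x` is the matrix with the largest height function whose value at
(row, column) is at most the given height (`meetIrr_ht`). Hence `A ≤ meetIrr x` is a condition on a
single value of the height function of `A` (`mem_upperOf_iff`), the elements `meetIrr x` are
meet-prime, and `A ↦ upperOf A` is an isomorphism from the lattice of alternating sign matrices to
the lattice of upper sets of the tetrahedron (`asmIsoUpperSet`). The points of `m(A)` are the
ascents of `A`, with their heights.

Everything is compared with the condition `NoCrossing A`: no point of `m(A)` lies strictly
north-east of another one.

* Covexillary permutations. From a position where the height function increases to the west and to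
  the south, a steepest descent ends at an ascent weakly north-east of it
  (`exists_mem_meetAntichain_northEast`), and symmetrically for the south-west. An entry `-1` is a
  saddle of the height function, so it yields a crossing, and so does a pattern `3412`. Conversely
  the entries next to two crossing ascents form a pattern `3412`.
* Depth antichains. Without a crossing, the distance of two points of the antichain `m(A)` is
  visible in their projections; so these are incomparable and the depth is a Lipschitz function of
  them. A depth antichain extends to a depth triangle by the formula of McShane, where parity turns
  the Lipschitz condition into steps `±1`.
* Walls. The graph of a depth triangle is a wall. Conversely, an embedding of the triangle into the
  tetrahedron preserves ranks and permutes the minimal elements, keeping neighbours adjacent; so up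
  to the reflection of the triangle it is a section of the projection (`proj_embedding`), and the
  depth along it is a depth triangle.
* Congruences. The Stanley lattice is the lattice of upper sets of the triangle
  (`stanleyIsoUpperSet`). Congruences of a finite lattice of upper sets whose quotient is the
  lattice of upper sets of a poset `D` correspond to copies of `D` among the meet-irreducible elements, and
  the maxima of the classes are the meets of elements of the copy (`restrictCon`,
  `exists_subset_of_congruence`).

A depth antichain lifts to an antichain of the tetrahedron, which is `m(A)` for a unique `A`; this
gives the bijection with depth antichains.
-/

namespace AlternatingSign

/-! ### Height functions with natural number indices -/

/-- The height function of `A`, as a function of two natural numbers. Its values are meaningful at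
`i, j ≤ n` only. -/
def ASM.ht {n : ℕ} (A : ASM n) (i j : ℕ) : ℤ := (i : ℤ) + j - 2 * cornerSum A.toMatrix i j

theorem ASM.toHFM_apply {n : ℕ} (A : ASM n) (i j : Fin (n + 1)) :
    A.toHFM.toFun i j = A.ht i.val j.val := rfl

theorem ASM.le_iff_ht {n : ℕ} {A B : ASM n} :
    A ≤ B ↔ ∀ i j : ℕ, i ≤ n → j ≤ n → A.ht i j ≤ B.ht i j :=
  ⟨fun h i j hi hj => h ⟨i, by omega⟩ ⟨j, by omega⟩,
    fun h i j => h i.val j.val (by omega) (by omega)⟩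

theorem ASM.ht_even {n : ℕ} (A : ASM n) (i j : ℕ) : ∃ c : ℤ, A.ht i j = i + j - 2 * c := ⟨_, rfl⟩

theorem ASM.ht_zero_left {n : ℕ} (A : ASM n) (j : ℕ) : A.ht 0 j = j := by
  simp [ASM.ht, cornerSum_eq_row, partialSum_zero]

theorem ASM.ht_zero_right {n : ℕ} (A : ASM n) (i : ℕ) : A.ht i 0 = i := by
  simp [ASM.ht, cornerSum_eq_col, partialSum_zero]

theorem ASM.ht_last {n : ℕ} (A : ASM n) : A.ht n n = 0 := by
  have := A.toHFM.last_row (Fin.last n)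
  rw [ASM.toHFM_apply] at this
  simpa using this

theorem ASM.ht_succ_left {n : ℕ} (A : ASM n) (i : Fin n) (j : ℕ) :
    A.ht (i.val + 1) j = A.ht i.val j + 1 - 2 * partialSum (fun j' => A.toMatrix i j') j := by
  rw [ASM.ht, ASM.ht, cornerSum_succ_row]
  push_cast
  ring

theorem ASM.ht_succ_right {n : ℕ} (A : ASM n) (i : ℕ) (j : Fin n) :
    A.ht i (j.val + 1) = A.ht i j.val + 1 - 2 * partialSum (fun i' => A.toMatrix i' j) i := by
  rw [ASM.ht, ASM.ht, cornerSum_succ_col]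
  push_cast
  ring

theorem ASM.ht_step_left {n : ℕ} (A : ASM n) {i j : ℕ} (hi : i < n) (hj : j ≤ n) :
    A.ht (i + 1) j = A.ht i j + 1 ∨ A.ht (i + 1) j = A.ht i j - 1 := by
  have h := A.ht_succ_left ⟨i, hi⟩ j
  have := (A.row ⟨i, hi⟩).partialSum_mem j hj
  simp only at h
  omega

theorem ASM.ht_step_right {n : ℕ} (A : ASM n) {i j : ℕ} (hi : i ≤ n) (hj : j < n) :
    A.ht i (j + 1) = A.ht i j + 1 ∨ A.ht i (j + 1) = A.ht i j - 1 := by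
  have h := A.ht_succ_right i ⟨j, hj⟩
  have := (A.col ⟨j, hj⟩).partialSum_mem i hi
  simp only at h
  omega

theorem ASM.ht_lipschitz_left {n : ℕ} (A : ASM n) {i k j : ℕ} (hik : i ≤ k) (hk : k ≤ n)
    (hj : j ≤ n) : |A.ht k j - A.ht i j| ≤ (k : ℤ) - i := by
  induction k, hik using Nat.le_induction with
  | base => simp
  | succ k hik ih =>
    have h1 := ih (by omega)
    have h2 := A.ht_step_left (i := k) (by omega) hj
    rw [abs_le] at *
    push_cast
    omega

theorem ASM.ht_lipschitz_right {n : ℕ} (A : ASM n) {i j l : ℕ} (hjl : j ≤ l) (hl : l ≤ n)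
    (hi : i ≤ n) : |A.ht i l - A.ht i j| ≤ (l : ℤ) - j := by
  induction l, hjl using Nat.le_induction with
  | base => simp
  | succ l hjl ih =>
    have h1 := ih (by omega)
    have h2 := A.ht_step_right (j := l) hi (by omega)
    rw [abs_le] at *
    push_cast
    omega

theorem ASM.ht_lipschitz {n : ℕ} (A : ASM n) {i j k l : ℕ} (hi : i ≤ n) (hj : j ≤ n) (hk : k ≤ n)
    (hl : l ≤ n) : |A.ht k l - A.ht i j| ≤ |(k : ℤ) - i| + |(l : ℤ) - j| := by
  have h1 : |A.ht k l - A.ht i l| ≤ |(k : ℤ) - i| := by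
    rcases le_total i k with h | h
    · exact (A.ht_lipschitz_left h hk hl).trans (le_abs_self _)
    · rw [abs_sub_comm, abs_sub_comm (k : ℤ)]
      exact (A.ht_lipschitz_left h hi hl).trans (le_abs_self _)
  have h2 : |A.ht i l - A.ht i j| ≤ |(l : ℤ) - j| := by
    rcases le_total j l with h | h
    · exact (A.ht_lipschitz_right h hl hi).trans (le_abs_self _)
    · rw [abs_sub_comm, abs_sub_comm (l : ℤ)]
      exact (A.ht_lipschitz_right h hj hi).trans (le_abs_self _)
  have h3 := abs_sub_le (A.ht k l) (A.ht i l) (A.ht i j)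
  omega

/-- The extreme values of a height function at a given position. -/
theorem ASM.ht_bounds {n : ℕ} (A : ASM n) {i j : ℕ} (hi : i ≤ n) (hj : j ≤ n) :
    A.ht i j ≤ i + j ∧ A.ht i j ≤ 2 * n - i - j ∧ (i : ℤ) - j ≤ A.ht i j ∧
      (j : ℤ) - i ≤ A.ht i j := by
  have h1 := A.ht_lipschitz_left (Nat.zero_le i) hi hj
  have h2 := A.ht_lipschitz_right (Nat.zero_le j) hj hi
  have h3 := A.ht_lipschitz le_rfl le_rfl hi hj
  rw [A.ht_last] at h3
  rw [A.ht_zero_left] at h1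
  rw [A.ht_zero_right] at h2
  rw [abs_le] at h1 h2 h3
  rw [abs_of_nonpos (by omega), abs_of_nonpos (by omega)] at h3
  push_cast at *
  omega

/-- Every function with the boundary values and the steps of a height function is the height
function of an alternating sign matrix. -/
theorem exists_asm_ht {n : ℕ} (f : ℕ → ℕ → ℤ) (h1 : ∀ j ≤ n, f 0 j = j) (h2 : ∀ i ≤ n, f i 0 = i)
    (h3 : ∀ j ≤ n, f n j = n - j) (h4 : ∀ i ≤ n, f i n = n - i)
    (h5 : ∀ i j, i ≤ n → j < n → |f i (j + 1) - f i j| = 1)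
    (h6 : ∀ i j, i < n → j ≤ n → |f (i + 1) j - f i j| = 1) :
    ∃ A : ASM n, ∀ i j, i ≤ n → j ≤ n → A.ht i j = f i j := by
  obtain ⟨A, hA⟩ := ASM.toHFM_surjective (n := n)
    { toFun := fun i j => f i.val j.val
      first_row := fun j => h1 _ (by omega)
      first_col := fun i => h2 _ (by omega)
      last_row := fun j => h3 _ (by omega)
      last_col := fun i => h4 _ (by omega)
      row_step := fun i j => h5 _ _ (by omega) (by omega)
      col_step := fun i j => h6 _ _ (by omega) (by omega) }
  refine ⟨A, fun i j hi hj => ?_⟩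
  exact congrFun (congrFun (congrArg HFM.toFun hA) ⟨i, by omega⟩) ⟨j, by omega⟩

theorem ASM.ht_inf {n : ℕ} (A B : ASM n) {i j : ℕ} (hi : i ≤ n) (hj : j ≤ n) :
    (A ⊓ B).ht i j = min (A.ht i j) (B.ht i j) := by
  have h : (A ⊓ B).toHFM = A.toHFM ⊓ B.toHFM :=
    (asmEquivHFM n).apply_symm_apply (asmEquivHFM n A ⊓ asmEquivHFM n B)
  exact congrFun (congrFun (congrArg HFM.toFun h) ⟨i, by omega⟩) ⟨j, by omega⟩

/-! ### The tetrahedron of meet-irreducible elements -/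

namespace Tetra

variable {n : ℕ} (x : Tetra n)

/-- The row of the only ascent of `meetIrr x`. -/
def row : ℕ := x.x₁ + x.x₂ + 1

/-- The column of the only ascent of `meetIrr x`. -/
def column : ℕ := x.x₁ + x.x₃ + 1

/-- The height of `meetIrr x` at its only ascent. -/
def height : ℕ := x.x₂ + x.x₃

theorem row_lt : x.row < n := by have := x.sum_eq; unfold row; omega

theorem column_lt : x.column < n := by have := x.sum_eq; unfold column; omega

/-- In the coordinates (row, column, height), one point lies below another one if the difference of
their heights is at least the taxicab distance of their positions. -/
theorem le_iff {x y : Tetra n} :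
    x ≤ y ↔ |(x.row : ℤ) - y.row| + |(x.column : ℤ) - y.column| ≤ (y.height : ℤ) - x.height := by
  change (y.x₁ ≤ x.x₁ ∧ x.x₂ ≤ y.x₂ ∧ x.x₃ ≤ y.x₃ ∧ y.x₄ ≤ x.x₄) ↔ _
  have := x.sum_eq
  have := y.sum_eq
  unfold row column height
  rcases abs_cases (((x.x₁ + x.x₂ + 1 : ℕ) : ℤ) - (y.x₁ + y.x₂ + 1 : ℕ)) with ⟨h, _⟩ | ⟨h, _⟩ <;>
  rcases abs_cases (((x.x₁ + x.x₃ + 1 : ℕ) : ℤ) - (y.x₁ + y.x₃ + 1 : ℕ)) with ⟨h', _⟩ | ⟨h', _⟩ <;>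
  rw [h, h'] <;> omega

theorem ext_iff' {x y : Tetra n} :
    x = y ↔ x.row = y.row ∧ x.column = y.column ∧ x.height = y.height := by
  refine ⟨by rintro rfl; simp, fun h => ?_⟩
  have := x.sum_eq
  have := y.sum_eq
  unfold row column height at h
  ext <;> omega

/-- The triples (row, column, height) that come from points of the tetrahedron. -/
theorem exists_of_bounds {i j : ℕ} {h : ℤ} (h1 : h + 2 ≤ i + j) (h2 : h + 2 ≤ 2 * n - i - j)
    (h3 : (i : ℤ) - j ≤ h) (h4 : (j : ℤ) - i ≤ h) (h5 : ∃ c : ℤ, h = i + j - 2 * c) :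
    ∃ x : Tetra n, x.row = i ∧ x.column = j ∧ (x.height : ℤ) = h := by
  obtain ⟨c, rfl⟩ := h5
  refine ⟨⟨(c - 1).toNat, (i - c).toNat, (j - c).toNat, (n - 1 - i - j + c).toNat, ?_⟩, ?_, ?_, ?_⟩
  · omega
  · simp only [row]; omega
  · simp only [column]; omega
  · simp only [height]; omega

end Tetra

instance (n : ℕ) : Finite (Tetra n) :=
  Finite.of_injective
    (fun x : Tetra n => ((⟨x.row, x.row_lt⟩, ⟨x.column, x.column_lt⟩,
      ⟨x.height, by have := x.sum_eq; unfold Tetra.height; omega⟩) : Fin n × Fin n × Fin n))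
    fun x y h => by
      simp only [Prod.mk.injEq, Fin.mk.injEq] at h
      exact Tetra.ext_iff'.2 h

/-! ### Meet-irreducible elements and Birkhoff's representation -/

theorem partialSum_permMatrix {n : ℕ} (σ : Equiv.Perm (Fin n)) (i : Fin n) (j : ℕ) :
    partialSum (fun j' => (permASM σ).toMatrix i j') j = if (σ i).val < j then 1 else 0 := by
  simp only [partialSum, permASM, Equiv.Perm.permMatrix, PEquiv.toMatrix_apply,
    Equiv.toPEquiv_apply, Option.mem_def, Option.some.injEq]
  rw [Finset.sum_eq_single (σ i)]
  · simp
  · intro b _ hb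
    simp [hb.symm]
  · simp

theorem partialSum_permMatrix_col {n : ℕ} (σ : Equiv.Perm (Fin n)) (i : ℕ) (j : Fin n) :
    partialSum (fun i' => (permASM σ).toMatrix i' j) i = if (σ.symm j).val < i then 1 else 0 := by
  simp only [partialSum, permASM, Equiv.Perm.permMatrix, PEquiv.toMatrix_apply,
    Equiv.toPEquiv_apply, Option.mem_def, Option.some.injEq]
  rw [Finset.sum_eq_single (σ.symm j)]
  · simp
  · intro b _ hb
    have : σ b ≠ j := fun h => hb (by rw [← h, Equiv.symm_apply_apply])
    simp [this]
  · simp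

/-- The height function of `meetIrr x` is the largest one whose value at the position of `x` is at
most the height of `x`. -/
theorem meetIrr_ht {n : ℕ} (x : Tetra n) {k l : ℕ} (hk : k ≤ n) (hl : l ≤ n) :
    (meetIrr x).ht k l = min (min ((k : ℤ) + l) (2 * n - k - l))
      (x.height + (|(k : ℤ) - x.row| + |(l : ℤ) - x.column|)) := by
  induction k with
  | zero =>
    rw [ASM.ht_zero_left]
    have := x.sum_eq
    unfold Tetra.row Tetra.column Tetra.height
    rcases abs_cases (((0 : ℕ) : ℤ) - (x.x₁ + x.x₂ + 1 : ℕ)) with ⟨h, _⟩ | ⟨h, _⟩ <;>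
    rcases abs_cases ((l : ℤ) - (x.x₁ + x.x₃ + 1 : ℕ)) with ⟨h', _⟩ | ⟨h', _⟩ <;>
    rw [h, h'] <;> omega
  | succ k ih =>
    have h1 := (meetIrr x).ht_succ_left ⟨k, hk⟩ l
    simp only at h1
    rw [h1, ih (by omega), meetIrr, partialSum_permMatrix]
    have hs := x.sum_eq
    simp only [antiPerm, Equiv.coe_fn_mk]
    obtain ⟨a, b, c, d, _⟩ := x
    simp only [Tetra.row, Tetra.column, Tetra.height] at *
    clear h1 ih
    obtain ⟨r, hr⟩ : ∃ r : ℤ, r = |(k : ℤ) - (a + b + 1 : ℕ)| := ⟨_, rfl⟩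
    obtain ⟨r', hr'⟩ : ∃ r' : ℤ, r' = |((k + 1 : ℕ) : ℤ) - (a + b + 1 : ℕ)| := ⟨_, rfl⟩
    obtain ⟨s, hs'⟩ : ∃ s : ℤ, s = |(l : ℤ) - (a + c + 1 : ℕ)| := ⟨_, rfl⟩
    rw [← hr, ← hr', ← hs']
    have h2 : (k < a + b + 1 ∧ r = a + b + 1 - k ∧ r' = r - 1) ∨
        (a + b + 1 ≤ k ∧ r = k - (a + b + 1) ∧ r' = r + 1) := by
      rcases abs_cases ((k : ℤ) - (a + b + 1 : ℕ)) with h | h <;>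
      rcases abs_cases (((k + 1 : ℕ) : ℤ) - (a + b + 1 : ℕ)) with h' | h' <;>
      omega
    have h3 : (l < a + c + 1 ∧ s = a + c + 1 - l) ∨ (a + c + 1 ≤ l ∧ s = l - (a + c + 1)) := by
      rcases abs_cases ((l : ℤ) - (a + c + 1 : ℕ)) with h | h <;> omega
    clear hr hr' hs'
    unfold antiColumn
    push_cast
    rcases h2 with ⟨h2, rfl, rfl⟩ | ⟨h2, rfl, rfl⟩ <;> rcases h3 with ⟨h3, rfl⟩ | ⟨h3, rfl⟩ <;>
    split_ifs <;> omega

/-- An alternating sign matrix lies below `meetIrr x` if and only if it does so at the position of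
`x`; in particular `meetIrr x` is meet-prime. -/
theorem mem_upperOf_iff {n : ℕ} {A : ASM n} {x : Tetra n} :
    x ∈ upperOf A ↔ A.ht x.row x.column ≤ x.height := by
  have hr := x.row_lt
  have hc := x.column_lt
  change A ≤ meetIrr x ↔ _
  rw [ASM.le_iff_ht]
  constructor
  · intro h
    refine (h _ _ hr.le hc.le).trans ?_
    rw [meetIrr_ht x hr.le hc.le]
    simp
  · intro h i j hi hj
    rw [meetIrr_ht x hi hj]
    have h1 := A.ht_bounds hi hj
    have h2 := le_of_abs_le (A.ht_lipschitz hr.le hc.le hi hj)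
    refine le_min (le_min ?_ ?_) ?_ <;> omega

theorem meetIrr_le_meetIrr {n : ℕ} {x y : Tetra n} : meetIrr x ≤ meetIrr y ↔ x ≤ y := by
  have hr := y.row_lt
  have hc := y.column_lt
  have h : meetIrr x ≤ meetIrr y ↔ _ := mem_upperOf_iff (A := meetIrr x)
  rw [h, meetIrr_ht x hr.le hc.le, Tetra.le_iff, abs_sub_comm (x.row : ℤ),
    abs_sub_comm (x.column : ℤ)]
  have h1 : (y.height : ℤ) < (y.row : ℤ) + y.column := by
    unfold Tetra.height Tetra.row Tetra.column; omega
  have h2 : (y.height : ℤ) < 2 * n - y.row - y.column := by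
    have := y.sum_eq
    unfold Tetra.height Tetra.row Tetra.column; omega
  constructor
  · intro h
    rcases min_le_iff.1 h with h | h
    · rcases min_le_iff.1 h with h | h <;> omega
    · omega
  · intro h
    exact (min_le_right _ _).trans (by omega)

theorem isUpperSet_upperOf {n : ℕ} (A : ASM n) : IsUpperSet (upperOf A) :=
  fun _ _ hxy hx => le_trans (show A ≤ _ from hx) (meetIrr_le_meetIrr.2 hxy)

/-- The points above `A` over a given position determine the height of `A` at this position. -/
theorem ht_le_of_upperOf {n : ℕ} {A B : ASM n} {i j : ℕ} (hi : i ≤ n) (hj : j ≤ n)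
    (h : ∀ x ∈ upperOf B, x.row = i → x.column = j → x ∈ upperOf A) : A.ht i j ≤ B.ht i j := by
  have h1 := A.ht_bounds hi hj
  have h2 := B.ht_bounds hi hj
  obtain ⟨a, ha⟩ := A.ht_even i j
  obtain ⟨b, hb⟩ := B.ht_even i j
  by_cases hB : B.ht i j + 2 ≤ i + j ∧ B.ht i j + 2 ≤ 2 * n - i - j
  · obtain ⟨x, rfl, rfl, hx⟩ := Tetra.exists_of_bounds hB.1 hB.2 h2.2.2.1 h2.2.2.2 ⟨b, hb⟩
    have h3 := mem_upperOf_iff.1 (h x (mem_upperOf_iff.2 hx.ge) rfl rfl)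
    omega
  · omega

theorem le_iff_upperOf_subset {n : ℕ} {A B : ASM n} : A ≤ B ↔ upperOf B ⊆ upperOf A :=
  ⟨fun h _ hx => h.trans (show B ≤ _ from hx), fun h => ASM.le_iff_ht.2 fun _ _ hi hj =>
    ht_le_of_upperOf hi hj fun _ hx _ _ => h hx⟩

theorem upperOf_inf {n : ℕ} (A B : ASM n) : upperOf (A ⊓ B) = upperOf A ∪ upperOf B := by
  ext x
  simp only [Set.mem_union, mem_upperOf_iff, ASM.ht_inf A B x.row_lt.le x.column_lt.le,
    min_le_iff]

theorem upperOf_meetIrr {n : ℕ} (x : Tetra n) : upperOf (meetIrr x) = Set.Ici x := by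
  ext y
  exact meetIrr_le_meetIrr

/-- The maximum of the lattice lies below no meet-irreducible element. -/
theorem exists_upperOf_eq_empty (n : ℕ) : ∃ A : ASM n, upperOf A = ∅ := by
  obtain ⟨A, hA⟩ := exists_asm_ht (n := n) (fun i j => min ((i : ℤ) + j) (2 * n - i - j))
    (by intros; omega) (by intros; omega) (by intros; omega) (by intros; omega)
    (by intros; rw [abs_eq (by norm_num)]; omega) (by intros; rw [abs_eq (by norm_num)]; omega)
  refine ⟨A, Set.eq_empty_of_forall_notMem fun x hx => ?_⟩
  rw [mem_upperOf_iff, hA _ _ x.row_lt.le x.column_lt.le] at hx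
  have := x.sum_eq
  unfold Tetra.row Tetra.column Tetra.height at hx
  omega

/-- Every upper set of the tetrahedron is a finite union of principal ones, and unions correspond to
meets. -/
theorem exists_upperOf_eq {n : ℕ} (U : UpperSet (Tetra n)) : ∃ A : ASM n, upperOf A = U := by
  have key : ∀ X : Set (Tetra n), ∃ A : ASM n, upperOf A = {z | ∃ x ∈ X, x ≤ z} := by
    intro X
    induction X, X.toFinite using Set.Finite.induction_on with
    | empty => simpa using exists_upperOf_eq_empty n
    | @insert x _ _ _ ih =>
      obtain ⟨A, hA⟩ := ih
      refine ⟨meetIrr x ⊓ A, ?_⟩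
      rw [upperOf_inf, hA, upperOf_meetIrr]
      ext z
      simp
  obtain ⟨A, hA⟩ := key U
  refine ⟨A, hA.trans ?_⟩
  ext z
  exact ⟨fun ⟨x, hx, hxz⟩ => U.upper hxz hx, fun hz => ⟨z, hz, le_rfl⟩⟩

/-- Birkhoff's representation of the lattice of alternating sign matrices: `A` corresponds to the
upper set of the meet-irreducible elements above `A`. -/
noncomputable def asmIsoUpperSet (n : ℕ) : ASM n ≃o UpperSet (Tetra n) where
  toEquiv := Equiv.ofBijective (fun A => ⟨upperOf A, isUpperSet_upperOf A⟩)
    ⟨fun A B h => by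
      have h' : upperOf A = upperOf B := congrArg UpperSet.carrier h
      exact le_antisymm (le_iff_upperOf_subset.2 h'.ge) (le_iff_upperOf_subset.2 h'.le),
    fun U => by
      obtain ⟨A, hA⟩ := exists_upperOf_eq U
      exact ⟨A, UpperSet.ext hA⟩⟩
  map_rel_iff' := le_iff_upperOf_subset.symm

theorem exists_meetAntichain_le {n : ℕ} {A : ASM n} {x : Tetra n} (hx : x ∈ upperOf A) :
    ∃ y ∈ meetAntichain A, y ≤ x := by
  obtain ⟨y, hy, hm⟩ := (upperOf A).toFinite.exists_le_minimal hx
  exact ⟨y, hm, hy⟩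

/-! ### Ascents and covexillary permutations -/

/-- Minimal points above `A` lie on the graph of the height function. -/
theorem ht_eq_height {n : ℕ} {A : ASM n} {x : Tetra n} (hx : x ∈ meetAntichain A) :
    A.ht x.row x.column = x.height := by
  have hr := x.row_lt
  have hc := x.column_lt
  have h1 := mem_upperOf_iff.1 hx.1
  have h2 := A.ht_bounds hr.le hc.le
  have h3 : (x.height : ℤ) + 2 ≤ x.row + x.column := by
    unfold Tetra.height Tetra.row Tetra.column; omega
  have h4 : (x.height : ℤ) + 2 ≤ 2 * n - x.row - x.column := by
    have := x.sum_eq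
    unfold Tetra.height Tetra.row Tetra.column; omega
  obtain ⟨y, hy1, hy2, hy3⟩ := Tetra.exists_of_bounds (n := n) (i := x.row) (j := x.column)
    (h := A.ht x.row x.column) (by omega) (by omega) h2.2.2.1 h2.2.2.2 (A.ht_even _ _)
  have hyx : y ≤ x := by
    rw [Tetra.le_iff, hy1, hy2]
    simp
    omega
  have hyA : y ∈ upperOf A := by
    rw [mem_upperOf_iff, hy1, hy2, hy3]
  rw [← hy3, hx.eq_of_le hyA hyx]

/-- The minimal points above `A` mark ascents of `A`: removing the point from the upper set of `A`
raises the height function at its position only. -/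
theorem isAscent_of_mem_meetAntichain {n : ℕ} {A : ASM n} {x : Tetra n}
    (hx : x ∈ meetAntichain A) :
    IsAscent A ⟨x.row, by have := x.row_lt; omega⟩ ⟨x.column, by have := x.column_lt; omega⟩ := by
  have hr := x.row_lt
  have hc := x.column_lt
  have hU : IsUpperSet (upperOf A \ {x}) := by
    intro y z hyz hy
    refine ⟨isUpperSet_upperOf A hyz hy.1, ?_⟩
    rintro rfl
    exact hy.2 (hx.eq_of_le hy.1 hyz)
  obtain ⟨A', hA'⟩ := exists_upperOf_eq ⟨_, hU⟩
  change upperOf A' = upperOf A \ {x} at hA'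
  have hle : A ≤ A' := le_iff_upperOf_subset.2 (hA' ▸ Set.sdiff_subset)
  have hne : ∀ k l : ℕ, k ≤ n → l ≤ n → (k ≠ x.row ∨ l ≠ x.column) → A'.ht k l = A.ht k l := by
    intro k l hk hl hkl
    refine le_antisymm (ht_le_of_upperOf hk hl fun y hy h1 h2 => ?_)
      (ASM.le_iff_ht.1 hle k l hk hl)
    rw [hA']
    refine ⟨hy, ?_⟩
    rintro rfl
    rcases hkl with h | h
    · exact h h1.symm
    · exact h h2.symm
  refine ⟨A', ?_, fun k l hkl => ?_⟩
  · rw [ASM.toHFM_apply, ASM.toHFM_apply]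
    simp only
    have h1 : ¬ A'.ht x.row x.column ≤ x.height := by
      rw [← mem_upperOf_iff, hA']
      simp
    have h2 := ht_eq_height hx
    obtain ⟨a, ha⟩ := A.ht_even x.row x.column
    obtain ⟨b, hb⟩ := A'.ht_even x.row x.column
    obtain ⟨r, hr'⟩ : ∃ r, x.row = r + 1 := ⟨_, rfl⟩
    rw [hr'] at hr h1 ha hb h2 ⊢
    have h3 := A.ht_step_left (i := r) (j := x.column) (by omega) hc.le
    have h4 := A'.ht_step_left (i := r) (j := x.column) (by omega) hc.le
    have h5 := hne r x.column (by omega) hc.le (Or.inl (by omega))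
    omega
  · refine hne k.val l.val (by omega) (by omega) ?_
    by_contra! h
    exact hkl (Prod.ext (Fin.ext h.1) (Fin.ext h.2))

/-- Every ascent of `A` is the position of a minimal point above `A`. -/
theorem exists_mem_meetAntichain_of_isAscent {n : ℕ} {A : ASM n} {i j : Fin (n + 1)}
    (h : IsAscent A i j) : ∃ x ∈ meetAntichain A, x.row = i.val ∧ x.column = j.val := by
  obtain ⟨A', h1, h2⟩ := h
  simp only [ASM.toHFM_apply] at h1 h2
  have hi : i.val ≤ n := by omega
  have hj : j.val ≤ n := by omega
  have h3 := A'.ht_bounds hi hj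
  have h4 := A.ht_bounds hi hj
  obtain ⟨x, hx1, hx2, hx3⟩ := Tetra.exists_of_bounds (n := n) (by omega) (by omega) h4.2.2.1
    h4.2.2.2 (A.ht_even i.val j.val)
  have hx : x ∈ upperOf A := by rw [mem_upperOf_iff, hx1, hx2, hx3]
  obtain ⟨y, hy, hyx⟩ := exists_meetAntichain_le hx
  refine ⟨y, hy, ?_⟩
  by_contra hne
  have h5 : A'.ht y.row y.column = A.ht y.row y.column := by
    refine h2 ⟨y.row, by have := y.row_lt; omega⟩ ⟨y.column, by have := y.column_lt; omega⟩ ?_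
    intro h
    rw [Prod.mk.injEq] at h
    exact hne ⟨congrArg Fin.val h.1, congrArg Fin.val h.2⟩
  -- The raised matrix still lies below `meetIrr y`, hence below `meetIrr x`.
  have h6 : y ∈ upperOf A' := by rw [mem_upperOf_iff, h5, ht_eq_height hy]
  have h7 := mem_upperOf_iff.1 (isUpperSet_upperOf A' hyx h6)
  rw [hx1, hx2] at h7
  omega

/-- At an ascent, the height function has a strict local minimum. -/
theorem ht_neighbours {n : ℕ} {A : ASM n} {x : Tetra n} (hx : x ∈ meetAntichain A) :
    A.ht (x.row + 1) x.column = A.ht x.row x.column + 1 ∧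
    A.ht x.row (x.column + 1) = A.ht x.row x.column + 1 ∧
    (∀ r, x.row = r + 1 → A.ht r x.column = A.ht x.row x.column + 1) ∧
    (∀ c, x.column = c + 1 → A.ht x.row c = A.ht x.row x.column + 1) := by
  have hr := x.row_lt
  have hc := x.column_lt
  obtain ⟨A', h1, h2⟩ := isAscent_of_mem_meetAntichain hx
  simp only [ASM.toHFM_apply] at h1 h2
  have h3 : ∀ k l : ℕ, k ≤ n → l ≤ n → (k ≠ x.row ∨ l ≠ x.column) → A'.ht k l = A.ht k l := by
    intro k l hk hl hkl
    refine h2 ⟨k, by omega⟩ ⟨l, by omega⟩ fun h => ?_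
    simp only [Prod.mk.injEq, Fin.mk.injEq] at h
    omega
  refine ⟨?_, ?_, fun r h => ?_, fun c h => ?_⟩
  · have := A.ht_step_left hr hc.le
    have := A'.ht_step_left hr hc.le
    have := h3 (x.row + 1) x.column hr hc.le (by omega)
    omega
  · have := A.ht_step_right hr.le hc
    have := A'.ht_step_right hr.le hc
    have := h3 x.row (x.column + 1) hr.le hc (by omega)
    omega
  · have h4 := A.ht_step_left (i := r) (by omega) hc.le
    have h5 := A'.ht_step_left (i := r) (by omega) hc.le
    have := h3 r x.column (by omega) hc.le (by omega)
    rw [← h] at h4 h5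
    omega
  · have h4 := A.ht_step_right (j := c) hr.le (by omega)
    have h5 := A'.ht_step_right (j := c) hr.le (by omega)
    have := h3 x.row c hr.le (by omega) (by omega)
    rw [← h] at h4 h5
    omega

/-- No two points of `m(A)` are strictly north-east and south-west of each other. -/
def NoCrossing {n : ℕ} (A : ASM n) : Prop :=
  ∀ x ∈ meetAntichain A, ∀ y ∈ meetAntichain A, ¬ (x.row < y.row ∧ y.column < x.column)

theorem noCrossing_iff {n : ℕ} {A : ASM n} : NoCrossing A ↔
    ¬ ∃ i j k l : Fin (n + 1), IsAscent A i j ∧ IsAscent A k l ∧ i < k ∧ l < j := by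
  constructor
  · rintro h ⟨i, j, k, l, h1, h2, h3, h4⟩
    obtain ⟨x, hx, hx1, hx2⟩ := exists_mem_meetAntichain_of_isAscent h1
    obtain ⟨y, hy, hy1, hy2⟩ := exists_mem_meetAntichain_of_isAscent h2
    exact h x hx y hy ⟨by rw [hx1, hy1]; exact h3, by rw [hx2, hy2]; exact h4⟩
  · intro h x hx y hy hxy
    exact h ⟨_, _, _, _, isAscent_of_mem_meetAntichain hx, isAscent_of_mem_meetAntichain hy, hxy⟩

/-- Descending from a position where the height function increases to the west and to the south,
one reaches an ascent weakly north-east of this position. -/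
theorem exists_mem_meetAntichain_northEast {n : ℕ} {A : ASM n} {r s : ℕ} (hr : r < n) (hs : s < n)
    (h1 : A.ht r s = A.ht r (s + 1) + 1) (h2 : A.ht (r + 1) (s + 1) = A.ht r (s + 1) + 1) :
    ∃ y ∈ meetAntichain A, y.row ≤ r ∧ s + 1 ≤ y.column := by
  have b1 := A.ht_bounds hr.le hs.le
  have b2 := A.ht_bounds (show r + 1 ≤ n by omega) (show s + 1 ≤ n by omega)
  have b3 := A.ht_bounds hr.le (show s + 1 ≤ n by omega)
  push_cast at b1 b2 b3
  obtain ⟨x, rfl, hx2, hx3⟩ := Tetra.exists_of_bounds (n := n) (i := r) (j := s + 1)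
    (h := A.ht r (s + 1)) (by push_cast; omega) (by push_cast; omega) (by push_cast; omega)
    (by push_cast; omega) (A.ht_even _ _)
  have hx : x ∈ upperOf A := by rw [mem_upperOf_iff, hx2, hx3]
  obtain ⟨y, hy, hyx⟩ := exists_meetAntichain_le hx
  have h3 := ht_eq_height hy
  have hyr := y.row_lt
  have hyc := y.column_lt
  rw [Tetra.le_iff, hx2, hx3] at hyx
  refine ⟨y, hy, ?_, ?_⟩
  · by_contra! h
    have h4 := le_of_abs_le (A.ht_lipschitz hyr.le hyc.le (show x.row + 1 ≤ n by omega)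
      (show s + 1 ≤ n by omega))
    rw [abs_sub_comm, abs_sub_comm _ (y.column : ℤ), abs_of_nonneg (by omega)] at h4
    rw [abs_of_nonneg (by omega)] at hyx
    push_cast at *
    omega
  · by_contra! h
    have h4 := le_of_abs_le (A.ht_lipschitz hyr.le hyc.le hr.le hs.le)
    rw [abs_sub_comm, abs_sub_comm _ (y.column : ℤ),
      abs_of_nonpos (a := (y.column : ℤ) - s) (by omega)] at h4
    rw [abs_of_nonpos (a := (y.column : ℤ) - (s + 1 : ℕ)) (by omega)] at hyx
    push_cast at *
    omega

/-- Descending from a position where the height function increases to the north and to the east,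
one reaches an ascent weakly south-west of this position. -/
theorem exists_mem_meetAntichain_southWest {n : ℕ} {A : ASM n} {r s : ℕ} (hr : r < n) (hs : s < n)
    (h1 : A.ht r s = A.ht (r + 1) s + 1) (h2 : A.ht (r + 1) (s + 1) = A.ht (r + 1) s + 1) :
    ∃ y ∈ meetAntichain A, r + 1 ≤ y.row ∧ y.column ≤ s := by
  have b1 := A.ht_bounds hr.le hs.le
  have b2 := A.ht_bounds (show r + 1 ≤ n by omega) (show s + 1 ≤ n by omega)
  have b3 := A.ht_bounds (show r + 1 ≤ n by omega) hs.le
  push_cast at b1 b2 b3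
  obtain ⟨x, hx1, rfl, hx3⟩ := Tetra.exists_of_bounds (n := n) (i := r + 1) (j := s)
    (h := A.ht (r + 1) s) (by push_cast; omega) (by push_cast; omega) (by push_cast; omega)
    (by push_cast; omega) (A.ht_even _ _)
  have hx : x ∈ upperOf A := by rw [mem_upperOf_iff, hx1, hx3]
  obtain ⟨y, hy, hyx⟩ := exists_meetAntichain_le hx
  have h3 := ht_eq_height hy
  have hyr := y.row_lt
  have hyc := y.column_lt
  rw [Tetra.le_iff, hx1, hx3] at hyx
  refine ⟨y, hy, ?_, ?_⟩
  · by_contra! h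
    have h4 := le_of_abs_le (A.ht_lipschitz hyr.le hyc.le hr.le hs.le)
    rw [abs_sub_comm, abs_sub_comm _ (y.column : ℤ),
      abs_of_nonpos (a := (y.row : ℤ) - r) (by omega)] at h4
    rw [abs_of_nonpos (a := (y.row : ℤ) - (r + 1 : ℕ)) (by omega)] at hyx
    push_cast at *
    omega
  · by_contra! h
    have h4 := le_of_abs_le (A.ht_lipschitz hyr.le hyc.le (show r + 1 ≤ n by omega)
      (show x.column + 1 ≤ n by omega))
    rw [abs_sub_comm, abs_sub_comm _ (y.column : ℤ),
      abs_of_nonneg (a := (y.column : ℤ) - _) (by push_cast; omega)] at h4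
    rw [abs_of_nonneg (a := (y.column : ℤ) - _) (by omega)] at hyx
    push_cast at *
    omega

/-- The height function has a saddle at an entry `-1`, with ascents on both sides. -/
theorem NoCrossing.entry_ne_neg_one {n : ℕ} {A : ASM n} (hA : NoCrossing A) (p q : Fin n) :
    A.toMatrix p q ≠ -1 := by
  intro h
  have e1 := A.ht_succ_left p q.val
  have e2 := A.ht_succ_left p (q.val + 1)
  have e3 := A.ht_succ_right p.val q
  have e4 := A.ht_succ_right (p.val + 1) q
  rw [partialSum_succ] at e2 e4
  have m1 := (A.row p).partialSum_mem q.val (by omega)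
  have m2 := (A.row p).partialSum_mem (q.val + 1) (by omega)
  have m3 := (A.col q).partialSum_mem p.val (by omega)
  have m4 := (A.col q).partialSum_mem (p.val + 1) (by omega)
  rw [partialSum_succ] at m2 m4
  simp only [h] at e2 e4 m2 m4
  obtain ⟨y, hy, hy1, hy2⟩ := exists_mem_meetAntichain_northEast (A := A) p.isLt q.isLt
    (by omega) (by omega)
  obtain ⟨z, hz, hz1, hz2⟩ := exists_mem_meetAntichain_southWest (A := A) p.isLt q.isLt
    (by omega) (by omega)
  exact hA y hy z hz ⟨by omega, by omega⟩

/-- An alternating vector without entry `-1` is a unit vector. -/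
theorem IsAlternating.exists_eq_single {n : ℕ} {v : Fin n → ℤ} (hv : IsAlternating v)
    (h : ∀ i, v i ≠ -1) : ∃ p, ∀ i, v i = if i = p then 1 else 0 := by
  have h0 : ∀ i, 0 ≤ v i := fun i => by
    have := hv.1 i
    have := h i
    omega
  obtain ⟨p, hp⟩ : ∃ p, v p ≠ 0 := by
    by_contra! hz
    have := hv.2.1
    simp [hz] at this
  refine ⟨p, fun i => ?_⟩
  have hp1 : v p = 1 := by
    have := hv.1 p
    have := h p
    omega
  split_ifs with hi
  · rw [hi, hp1]
  · have h1 := Finset.sum_le_sum_of_subset_of_nonneg (Finset.subset_univ {i, p})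
      fun k _ _ => h0 k
    rw [Finset.sum_pair hi, hv.2.1, hp1] at h1
    have := h0 i
    omega

theorem NoCrossing.exists_eq_permASM {n : ℕ} {A : ASM n} (hA : NoCrossing A) :
    ∃ σ : Equiv.Perm (Fin n), A = permASM σ := by
  choose f hf using fun i => (A.row i).exists_eq_single (hA.entry_ne_neg_one i)
  choose g hg using fun j => (A.col j).exists_eq_single fun i => hA.entry_ne_neg_one i j
  have hfg : ∀ i j, f i = j ↔ g j = i := by
    intro i j
    have h1 := hf i j
    have h2 := hg j i
    rw [h1] at h2
    constructor
    · rintro rfl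
      by_contra h
      simp [Ne.symm h] at h2
    · rintro rfl
      by_contra h
      simp [Ne.symm h] at h2
  refine ⟨⟨f, g, fun i => (hfg i _).1 rfl, fun j => (hfg _ j).2 rfl⟩, ?_⟩
  apply ASM.ext
  ext i j
  rw [hf i j]
  simp [permASM, Equiv.Perm.permMatrix, PEquiv.toMatrix_apply, eq_comm]

/-- A pattern `3412` at the rows `a < b < c < d` yields an ascent north-east of the position
`(b, σ a + 1)` and an ascent south-west of the position `(c + 1, σ d)`. -/
theorem NoCrossing.isCovexillary {n : ℕ} {σ : Equiv.Perm (Fin n)} (h : NoCrossing (permASM σ)) :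
    IsCovexillary σ := by
  rintro ⟨a, b, c, d, hab, hbc, hcd, h1, h2, h3⟩
  have e1 := (permASM σ).ht_succ_right b.val (σ a)
  have e2 := (permASM σ).ht_succ_left b ((σ a).val + 1)
  have e3 := (permASM σ).ht_succ_left c (σ d).val
  have e4 := (permASM σ).ht_succ_right (c.val + 1) (σ d)
  rw [partialSum_permMatrix_col, Equiv.symm_apply_apply, if_pos (by omega)] at e1
  rw [partialSum_permMatrix, if_neg (by omega)] at e2
  rw [partialSum_permMatrix, if_pos (by omega)] at e3
  rw [partialSum_permMatrix_col, Equiv.symm_apply_apply, if_neg (by omega)] at e4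
  obtain ⟨y, hy, hy1, hy2⟩ := exists_mem_meetAntichain_northEast (A := permASM σ) b.isLt
    (σ a).isLt (by omega) (by omega)
  obtain ⟨z, hz, hz1, hz2⟩ := exists_mem_meetAntichain_southWest (A := permASM σ) c.isLt
    (σ d).isLt (by omega) (by omega)
  exact h y hy z hz ⟨by omega, by omega⟩

/-- Two crossing ascents yield a pattern `3412`, formed by the entries of the column before and the
row after the first ascent and those of the row before and the column after the second one. -/
theorem IsCovexillary.noCrossing {n : ℕ} {σ : Equiv.Perm (Fin n)} (h : IsCovexillary σ) :
    NoCrossing (permASM σ) := by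
  rintro x hx y hy ⟨h1, h2⟩
  obtain ⟨x1, -, -, x4⟩ := ht_neighbours hx
  obtain ⟨-, y2, y3, -⟩ := ht_neighbours hy
  have hxr := x.row_lt
  have hxc := x.column_lt
  have hyr := y.row_lt
  have hyc := y.column_lt
  obtain ⟨j, hj⟩ : ∃ j, x.column = j + 1 := ⟨_, rfl⟩
  obtain ⟨k, hk⟩ : ∃ k, y.row = k + 1 := ⟨_, rfl⟩
  have x4 := x4 j hj
  have y3 := y3 k hk
  obtain ⟨i, hi⟩ : ∃ i : Fin n, i.val = x.row := ⟨⟨_, hxr⟩, rfl⟩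
  obtain ⟨j', hj'⟩ : ∃ j' : Fin n, j'.val = j := ⟨⟨j, by omega⟩, rfl⟩
  obtain ⟨k', hk'⟩ : ∃ k' : Fin n, k'.val = k := ⟨⟨k, by omega⟩, rfl⟩
  obtain ⟨l, hl⟩ : ∃ l : Fin n, l.val = y.column := ⟨⟨_, hyc⟩, rfl⟩
  have e1 := (permASM σ).ht_succ_left i x.column
  have e2 := (permASM σ).ht_succ_right x.row j'
  have e3 := (permASM σ).ht_succ_left k' y.column
  have e4 := (permASM σ).ht_succ_right y.row l
  rw [partialSum_permMatrix, hi] at e1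
  rw [partialSum_permMatrix_col, hj', ← hj] at e2
  rw [partialSum_permMatrix, hk', ← hk] at e3
  rw [partialSum_permMatrix_col, hl] at e4
  have f1 : ¬ (σ i).val < x.column := fun hlt => by rw [if_pos hlt] at e1; omega
  have f2 : (σ.symm j').val < x.row := by by_contra hlt; rw [if_neg hlt] at e2; omega
  have f3 : (σ k').val < y.column := by by_contra hlt; rw [if_neg hlt] at e3; omega
  have f4 : ¬ (σ.symm l).val < y.row := fun hlt => by rw [if_pos hlt] at e4; omega
  have g1 : i ≠ k' := by rintro rfl; omega
  have g2 : l ≠ j' := by rintro rfl; omega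
  have g1' : i.val ≠ k'.val := fun h => g1 (Fin.ext h)
  have g2' : l.val ≠ j'.val := fun h => g2 (Fin.ext h)
  refine h ⟨σ.symm j', i, k', σ.symm l, ?_, ?_, ?_, ?_, ?_, ?_⟩ <;>
    simp only [Equiv.apply_symm_apply, Fin.lt_def] <;> omega

theorem exists_isCovexillary_iff {n : ℕ} {A : ASM n} :
    (∃ σ : Equiv.Perm (Fin n), IsCovexillary σ ∧ A = permASM σ) ↔ NoCrossing A := by
  constructor
  · rintro ⟨σ, h, rfl⟩
    exact h.noCrossing
  · intro h
    obtain ⟨σ, rfl⟩ := h.exists_eq_permASM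
    exact ⟨σ, h.isCovexillary, rfl⟩

theorem permASM_injective {n : ℕ} : Function.Injective (permASM (n := n)) := by
  intro σ τ h
  ext1 i
  by_contra hne
  have h1 := congrFun (congrFun (congrArg ASM.toMatrix h) i) (τ i)
  simp [permASM, Equiv.Perm.permMatrix, PEquiv.toMatrix_apply, hne] at h1

/-! ### Congruences of lattices of upper sets -/

section Congruence

variable {L T D : Type*} [Lattice L] [PartialOrder T] [PartialOrder D]

/-- The order on the quotient in terms of representatives. -/
theorem quotLE_mk_iff (c : LatticeCon L) (a b : L) :
    quotLE c (Quotient.mk _ a) (Quotient.mk _ b) ↔ c.r (a ⊔ b) b := by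
  constructor
  · rintro ⟨x, y, hx, hy, hxy⟩
    have hx' : c.r x a := Quotient.exact hx
    have hy' : c.r y b := Quotient.exact hy
    have h := c.sup hx' hy'
    rw [sup_eq_right.2 hxy] at h
    exact c.trans (c.symm h) hy'
  · intro h
    exact ⟨a, a ⊔ b, rfl, Quotient.sound h, le_sup_left⟩

/-- The congruence of a lattice of upper sets of `T` that compares upper sets on `W ⊆ T` only. -/
def restrictCon (φ : L ≃o UpperSet T) (W : Set T) : LatticeCon L where
  r A B := ∀ x ∈ W, x ∈ φ A ↔ x ∈ φ B
  iseqv := ⟨fun _ _ _ => Iff.rfl, fun h x hx => (h x hx).symm,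
    fun h h' x hx => (h x hx).trans (h' x hx)⟩
  inf h h' x hx := by
    simp only [map_inf, UpperSet.mem_inf_iff, h x hx, h' x hx]
  sup h h' x hx := by
    simp only [map_sup, UpperSet.mem_sup_iff, h x hx, h' x hx]

/-- The quotient by `restrictCon φ W` is the lattice of upper sets of `W`. -/
theorem restrictCon_quotient (φ : L ≃o UpperSet T) {W : Set T} (g : W ≃o D) :
    Nonempty (quotLE (restrictCon φ W) ≃r ((· ≤ ·) : UpperSet D → UpperSet D → Prop)) := by
  let F : L → UpperSet D := fun A => ⟨{d | (g.symm d).val ∈ φ A}, fun d e hde hd =>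
    (φ A).upper (show (g.symm d).val ≤ (g.symm e).val from g.symm.monotone hde) hd⟩
  have hF : ∀ A d, d ∈ F A ↔ (g.symm d).val ∈ φ A := fun _ _ => Iff.rfl
  have hrel : ∀ A B, (restrictCon φ W).r A B ↔ F A = F B := by
    intro A B
    constructor
    · intro h
      ext d
      exact h _ (g.symm d).2
    · intro h x hx
      have := SetLike.ext_iff.1 h (g ⟨x, hx⟩)
      simpa [hF] using this
  refine ⟨⟨Equiv.ofBijective (Quotient.lift F fun A B h => (hrel A B).1 h) ⟨?_, ?_⟩, ?_⟩⟩
  · intro X Y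
    induction X using Quotient.inductionOn with | h A => ?_
    induction Y using Quotient.inductionOn with | h B => ?_
    exact fun h => Quotient.sound ((hrel A B).2 h)
  · intro V
    refine ⟨Quotient.mk _ (φ.symm (upperClosure ((fun d => (g.symm d).val) '' V))), ?_⟩
    ext d
    change (g.symm d).val ∈ φ (φ.symm _) ↔ _
    rw [OrderIso.apply_symm_apply]
    simp only [mem_upperClosure, Set.exists_mem_image, SetLike.mem_coe, Subtype.coe_le_coe,
      OrderIso.le_iff_le]
    exact ⟨fun ⟨e, he, hed⟩ => V.upper hed he, fun hd => ⟨d, hd, le_rfl⟩⟩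
  · intro X Y
    induction X using Quotient.inductionOn with | h A => ?_
    induction Y using Quotient.inductionOn with | h B => ?_
    rw [quotLE_mk_iff, hrel]
    change F A ≤ F B ↔ _
    constructor
    · intro h
      ext d
      rw [SetLike.mem_coe, SetLike.mem_coe, hF, map_sup, UpperSet.mem_sup_iff]
      exact ⟨fun h' => h'.2, fun h' => ⟨h h', h'⟩⟩
    · intro h d hd
      have hd' : d ∈ F (A ⊔ B) := h ▸ hd
      rw [hF, map_sup, UpperSet.mem_sup_iff] at hd'
      exact hd'.1

/-- An element whose upper set is generated within `W` is the maximum of its class. -/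
theorem restrictCon_isGreatest [Finite T] (φ : L ≃o UpperSet T) {W : Set T} {A : L}
    (hA : ∀ x, Minimal (· ∈ φ A) x → x ∈ W) : IsGreatest {B | (restrictCon φ W).r A B} A := by
  refine ⟨fun _ _ => Iff.rfl, fun B hB => ?_⟩
  rw [← φ.le_iff_le]
  intro z hz
  obtain ⟨x, hxz, hx⟩ := (Set.toFinite {x | x ∈ φ A}).exists_le_minimal hz
  exact (φ B).upper hxz ((hB x (hA x hx)).1 hx.1)

/-- If the quotient of a finite lattice of upper sets of `T` is the lattice of upper sets of `D`,
the meet-irreducible elements that are maximum of their class form a copy of `D` in `T`, and the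
upper set of every maximum of a class is generated by elements of this copy. -/
theorem exists_subset_of_congruence [Finite T] [Finite D] (φ : L ≃o UpperSet T) (c : LatticeCon L)
    (ψ : quotLE c ≃r ((· ≤ ·) : UpperSet D → UpperSet D → Prop)) {A : L}
    (hA : IsGreatest {B | c.r A B} A) :
    ∃ W : Set T, Nonempty (W ≃o D) ∧ ∀ x, Minimal (· ∈ φ A) x → x ∈ W := by
  have : Finite L := Finite.of_equiv _ φ.symm.toEquiv
  let q : L → UpperSet D := fun a => ψ (Quotient.mk _ a)
  have hq : ∀ a b, q a ≤ q b ↔ c.r (a ⊔ b) b := fun a b =>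
    (ψ.map_rel_iff).trans (quotLE_mk_iff c a b)
  have hqr : ∀ a b, q a = q b ↔ c.r a b := fun a b =>
    ψ.injective.eq_iff.trans ⟨fun h => Quotient.exact h, fun h => Quotient.sound h⟩
  have hmono : ∀ {a b}, a ≤ b → q a ≤ q b := fun {a b} h => (hq a b).2 (by
    rw [sup_eq_right.2 h])
  have hsurj : ∀ V, ∃ a, q a = V := by
    intro V
    obtain ⟨a, ha⟩ := Quotient.exists_rep (ψ.symm V)
    exact ⟨a, by simp only [q, ha, RelIso.apply_symm_apply]⟩
  have hinf : ∀ a b, q (a ⊓ b) = q a ⊓ q b := by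
    intro a b
    refine le_antisymm (le_inf (hmono inf_le_left) (hmono inf_le_right)) ?_
    obtain ⟨v, hv⟩ := hsurj (q a ⊓ q b)
    have key : ∀ a, q v ≤ q a → c.r (v ⊓ a) v := by
      intro a h
      have := c.inf (c.refl v) (c.symm ((hq v a).1 h))
      rwa [inf_eq_left.2 (le_sup_left : v ≤ v ⊔ a)] at this
    have h1 := key a (hv.le.trans inf_le_left)
    have h2 := key b (hv.le.trans inf_le_right)
    have h3 : c.r (v ⊓ a ⊓ b) v := c.trans (c.inf h1 (c.refl b)) h2
    rw [← hv, ← (hqr _ _).2 h3]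
    exact hmono (by rw [inf_assoc]; exact inf_le_right)
  -- The maximum of every class: the upper adjoint of `q`.
  have htop : ∀ V, ∃ t, q t = V ∧ ∀ b, q b ≤ V → b ≤ t := by
    intro V
    obtain ⟨a, ha⟩ := hsurj V
    obtain ⟨t, hat, ht⟩ := (Set.toFinite {b | q b ≤ V}).exists_le_maximal (show q a ≤ V from ha.le)
    refine ⟨t, le_antisymm ht.1 (ha ▸ hmono hat), fun b hb => ?_⟩
    have h1 : q (b ⊔ t) ≤ V := by
      obtain ⟨y, rfl⟩ : ∃ y, q y = V := ⟨a, ha⟩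
      have h1 := (hq b y).1 hb
      have h2 := (hq t y).1 ht.1
      refine (hq _ y).2 ?_
      have h3 := c.sup h1 h2
      rw [sup_idem] at h3
      rwa [← sup_sup_sup_comm, sup_idem] at h3
    exact le_sup_left.trans (ht.2 h1 le_sup_right)
  choose t htq htm using htop
  have htt : ∀ V V', t V ≤ t V' ↔ V ≤ V' := fun V V' =>
    ⟨fun h => by rw [← htq V, ← htq V']; exact hmono h, fun h => htm _ _ (by rwa [htq])⟩
  have hAt : t (q A) = A :=
    le_antisymm (hA.2 ((hqr _ _).1 (htq _).symm)) (htm _ _ le_rfl)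
  -- The maximum of a meet-irreducible class is meet-irreducible, so its upper set is principal.
  have hprin : ∀ d, ∃ x, UpperSet.Ici x = φ (t (UpperSet.Ici d)) := by
    intro d
    rw [← UpperSet.infIrred_iff_of_finite]
    have hd := UpperSet.infIrred_Ici d
    constructor
    · intro hmax
      refine hd.1 fun V hV => ?_
      have h1 : φ (t (UpperSet.Ici d)) ≤ φ (t V) := φ.monotone ((htt _ _).2 hV)
      exact (htt _ _).1 (φ.le_iff_le.1 (hmax h1))
    · intro b b' hbb
      obtain ⟨b, rfl⟩ := φ.surjective b
      obtain ⟨b', rfl⟩ := φ.surjective b'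
      rw [← map_inf] at hbb
      have hbb := φ.injective hbb
      have h1 : q b ⊓ q b' = UpperSet.Ici d := by rw [← hinf, hbb, htq]
      rcases hd.2 h1 with h | h
      · left
        exact congrArg φ (le_antisymm (htm _ _ h.le) (hbb ▸ inf_le_left))
      · right
        exact congrArg φ (le_antisymm (htm _ _ h.le) (hbb ▸ inf_le_right))
  choose w hw using hprin
  have hwle : ∀ d e, w d ≤ w e ↔ d ≤ e := fun d e => by
    
    rw [← UpperSet.mem_Ici_iff, ← UpperSet.le_Ici, hw, hw, φ.le_iff_le, htt, UpperSet.le_Ici,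
      UpperSet.mem_Ici_iff]
  refine ⟨Set.range w, ⟨(OrderEmbedding.ofMapLEIff w hwle).orderIso.symm⟩, fun x hx => ?_⟩
  -- `A` is the meet of the elements of the copy of `D` that lie above it.
  let a' : L := φ.symm (upperClosure (w '' (q A)))
  have hmem : ∀ d ∈ q A, w d ∈ φ A := by
    intro d hd
    have h1 : φ A ≤ φ (t (UpperSet.Ici d)) := by
      rw [φ.le_iff_le]
      conv_lhs => rw [← hAt]
      rw [htt]
      exact (UpperSet.le_Ici).2 hd
    rw [← hw, UpperSet.le_Ici] at h1
    exact h1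
  have h1 : a' ≤ A := by
    rw [← hAt]
    refine htm _ _ fun d hd => ?_
    have h2 : a' ≤ t (UpperSet.Ici d) := by
      rw [← φ.le_iff_le, ← hw, φ.apply_symm_apply, UpperSet.le_Ici]
      exact subset_upperClosure (Set.mem_image_of_mem w hd)
    have h3 := hmono h2
    rw [htq, UpperSet.le_Ici] at h3
    exact h3
  have h2 : x ∈ φ a' := (φ.monotone h1) hx.1
  rw [φ.apply_symm_apply] at h2
  obtain ⟨_, ⟨d, hd, rfl⟩, hdx⟩ := mem_upperClosure.1 h2
  exact ⟨d, hx.eq_of_le (hmem d hd) hdx⟩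

end Congruence

/-! ### The Stanley lattice -/

instance (n : ℕ) : Finite (Tri n) :=
  Finite.of_injective
    (fun y : Tri n => ((⟨y.y₁, by have := y.sum_eq; omega⟩, ⟨y.y₃, by have := y.sum_eq; omega⟩) :
      Fin n × Fin n))
    fun y z h => by
      simp only [Prod.mk.injEq, Fin.mk.injEq] at h
      have := y.sum_eq
      have := z.sum_eq
      ext <;> omega

theorem Tri.le_iff {n : ℕ} {y z : Tri n} :
    y ≤ z ↔ y.y₁ + y.y₂ ≤ z.y₁ + z.y₂ ∧ y.y₂ + y.y₃ ≤ z.y₂ + z.y₃ := Iff.rfl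

/-- The step of a Dyck path at which its height is compared with `y₂`. -/
def Tri.step {n : ℕ} (y : Tri n) : ℕ := 2 * y.y₁ + y.y₂ + 2

theorem Tri.le_iff_step {n : ℕ} {y z : Tri n} :
    y ≤ z ↔ |(z.step : ℤ) - y.step| ≤ (z.y₂ : ℤ) - y.y₂ := by
  rw [Tri.le_iff, abs_le]
  have := y.sum_eq
  have := z.sum_eq
  unfold Tri.step
  omega

namespace DyckPath

variable {n : ℕ} (P : DyckPath n)

theorem length_eq : P.val.toList.length = 2 * n := by
  rw [← DyckWord.two_mul_semilength_eq_length, P.2]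

theorem height_zero : P.height 0 = 0 := by simp [height]

theorem height_eq_zero {k : ℕ} (hk : 2 * n ≤ k) : P.height k = 0 := by
  rw [height, List.take_of_length_le (by rw [P.length_eq]; exact hk), P.val.count_U_eq_count_D]
  simp

theorem height_nonneg (k : ℕ) : 0 ≤ P.height k := by
  have := P.val.count_D_le_count_U k
  unfold height
  omega

theorem height_succ {k : ℕ} (hk : k < P.val.toList.length) :
    P.height (k + 1) = P.height k + if P.val.toList[k] = DyckStep.U then 1 else -1 := by
  unfold height
  rw [List.take_succ_eq_append_getElem hk, List.count_append, List.count_append]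
  rcases DyckStep.dichotomy P.val.toList[k] with h | h <;> rw [h] <;> simp <;> ring

theorem height_step {k : ℕ} (hk : k < 2 * n) :
    P.height (k + 1) = P.height k + 1 ∨ P.height (k + 1) = P.height k - 1 := by
  rw [P.height_succ (by rw [P.length_eq]; exact hk)]
  split_ifs
  · left; rfl
  · right; rfl

theorem height_le {k : ℕ} (hk : k ≤ 2 * n) : P.height k ≤ k ∧ ∃ c : ℤ, P.height k = k - 2 * c := by
  induction k with
  | zero => exact ⟨by simp [P.height_zero], 0, by simp [P.height_zero]⟩
  | succ k ih =>
    obtain ⟨h1, c, h2⟩ := ih (by omega)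
    push_cast
    rcases P.height_step (k := k) (by omega) with h | h
    · exact ⟨by omega, c, by omega⟩
    · exact ⟨by omega, c + 1, by omega⟩

theorem height_le' {k m : ℕ} (hk : k + m = 2 * n) : P.height k ≤ m := by
  induction m generalizing k with
  | zero => simp [P.height_eq_zero (show 2 * n ≤ k by omega)]
  | succ m ih =>
    have h1 := ih (k := k + 1) (by omega)
    have h2 := P.height_step (k := k) (by omega)
    push_cast
    omega

theorem ext_height {P Q : DyckPath n} (h : ∀ k, P.height k = Q.height k) : P = Q := by
  apply Subtype.ext
  apply DyckWord.ext
  refine List.ext_getElem (by rw [P.length_eq, Q.length_eq]) fun k h1 h2 => ?_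
  have e1 := P.height_succ h1
  have e2 := Q.height_succ h2
  rw [h, h, e2] at e1
  rcases DyckStep.dichotomy P.val.toList[k] with h3 | h3 <;>
  rcases DyckStep.dichotomy Q.val.toList[k] with h4 | h4 <;>
  simp [h3, h4] at e1 ⊢

/-- Every nonnegative sequence from `0` to `0` with `2 * n` steps `±1` is the sequence of heights of
a Dyck path. -/
theorem exists_height_eq (q : ℕ → ℤ) (h0 : q 0 = 0) (hn : q (2 * n) = 0)
    (hpos : ∀ k ≤ 2 * n, 0 ≤ q k) (hstep : ∀ k < 2 * n, |q (k + 1) - q k| = 1) :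
    ∃ P : DyckPath n, ∀ k ≤ 2 * n, P.height k = q k := by
  let f : ℕ → DyckStep := fun k => if q (k + 1) = q k + 1 then DyckStep.U else DyckStep.D
  have hcount : ∀ k ≤ 2 * n, (((List.range k).map f).count DyckStep.U : ℤ)
      - ((List.range k).map f).count DyckStep.D = q k := by
    intro k hk
    induction k with
    | zero => simp [h0]
    | succ k ih =>
      have h1 := ih (by omega)
      have h2 := hstep k (by omega)
      rw [abs_eq (by norm_num)] at h2
      rw [List.range_succ, List.map_append, List.count_append, List.count_append]
      by_cases h3 : q (k + 1) = q k + 1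
      · have h4 : f k = DyckStep.U := if_pos h3
        simp [h4]
        omega
      · have h4 : f k = DyckStep.D := if_neg h3
        simp [h4]
        omega
  have htake : ∀ k, ((List.range (2 * n)).map f).take k = (List.range (min k (2 * n))).map f := by
    intro k
    rw [← List.map_take, List.take_range]
  let w : DyckWord :=
    { toList := (List.range (2 * n)).map f
      count_U_eq_count_D := by
        have := hcount (2 * n) le_rfl
        omega
      count_D_le_count_U := fun k => by
        rw [htake]
        have h1 := hcount (min k (2 * n)) (by omega)
        have h2 := hpos (min k (2 * n)) (by omega)
        omega }
  have hw : w.semilength = n := by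
    have h1 := w.two_mul_semilength_eq_length
    have h2 : w.toList.length = 2 * n := by simp [w]
    omega
  refine ⟨⟨w, hw⟩, fun k hk => ?_⟩
  have h1 := htake k
  have h2 := hcount k hk
  rw [min_eq_left hk] at h1
  rw [← h1] at h2
  exact h2

/-- The upper set of the points of the triangle on or above a Dyck path. -/
def upperSet : UpperSet (Tri n) where
  carrier := {y | P.height y.step ≤ y.y₂}
  upper' := by
    have lip : ∀ k l : ℕ, k ≤ l → l ≤ 2 * n → |P.height l - P.height k| ≤ (l : ℤ) - k := by
      intro k l hkl hl
      induction l, hkl using Nat.le_induction with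
      | base => simp
      | succ l hkl ih =>
        have h1 := ih (by omega)
        have h2 := P.height_step (k := l) (by omega)
        rw [abs_le] at *
        push_cast
        omega
    intro y z hyz hy
    rw [Tri.le_iff_step, abs_le] at hyz
    have hy' : P.height y.step ≤ y.y₂ := hy
    change P.height z.step ≤ z.y₂
    have h1 : y.step ≤ 2 * n := by have := y.sum_eq; unfold Tri.step; omega
    have h2 : z.step ≤ 2 * n := by have := z.sum_eq; unfold Tri.step; omega
    rcases le_total y.step z.step with h | h
    · have := lip _ _ h h2
      rw [abs_le] at this
      omega
    · have := lip _ _ h h1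
      rw [abs_le] at this
      omega

theorem mem_upperSet {y : Tri n} : y ∈ P.upperSet ↔ P.height y.step ≤ y.y₂ := Iff.rfl

theorem stanleyLE_iff {P Q : DyckPath n} : stanleyLE P Q ↔ P.upperSet ≤ Q.upperSet := by
  constructor
  · intro h y hy
    exact (h _).trans hy
  · intro h k
    by_cases hk : 2 * n ≤ k
    · rw [P.height_eq_zero hk, Q.height_eq_zero hk]
    obtain ⟨m, hm⟩ : ∃ m, k + m = 2 * n := ⟨2 * n - k, by omega⟩
    obtain ⟨hP, a, ha⟩ := P.height_le (k := k) (by omega)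
    obtain ⟨hQ, b, hb⟩ := Q.height_le (k := k) (by omega)
    have hP' := P.height_le' hm
    have hQ0 := Q.height_nonneg k
    -- Unless `Q` is as high as possible after `k` steps, its point there belongs to the triangle.
    by_cases hlt : Q.height k + 2 ≤ k ∧ Q.height k + 2 ≤ m
    · let y : Tri n := ⟨(b - 1).toNat, (Q.height k).toNat, (n - 1 - k + b).toNat, by omega⟩
      have hy : y.step = k := by simp only [y, Tri.step]; omega
      have hyQ : y ∈ Q.upperSet := by
        rw [mem_upperSet, hy]
        simp only [y]
        omega
      have hyP := h hyQ
      change P.height y.step ≤ y.y₂ at hyP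
      rw [hy] at hyP
      simp only [y] at hyP
      omega
    · omega

/-- The path of an upper set is obtained from the highest path by taking minima with the cones
`k ↦ y₂ + |k - y.step|` over the points `y` of the upper set. -/
theorem exists_upperSet_eq (U : UpperSet (Tri n)) : ∃ P : DyckPath n, P.upperSet = U := by
  have key : ∀ X : Set (Tri n), ∃ P : DyckPath n,
      ∀ z, P.height z.step ≤ z.y₂ ↔ ∃ y ∈ X, y ≤ z := by
    intro X
    induction X, X.toFinite using Set.Finite.induction_on with
    | empty =>
      -- The highest Dyck path.
      obtain ⟨P, hP⟩ := exists_height_eq (n := n) (fun k => min (k : ℤ) (2 * n - k)) (by simp)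
        (by push_cast; omega) (by intros; omega)
        (by intros; rw [abs_eq (by norm_num)]; push_cast; omega)
      refine ⟨P, fun z => ?_⟩
      have := z.sum_eq
      rw [hP _ (by unfold Tri.step; omega)]
      simp
      unfold Tri.step
      push_cast
      omega
    | @insert y X _ _ ih =>
      obtain ⟨P, hP⟩ := ih
      have hy := y.sum_eq
      have hs : 2 ≤ y.step ∧ y.step + 2 ≤ 2 * n ∧ y.y₂ + 2 ≤ y.step ∧
          y.step + y.y₂ + 2 ≤ 2 * n := by unfold Tri.step; omega
      obtain ⟨Q, hQ⟩ := exists_height_eq (n := n)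
        (fun k => min (P.height k) (y.y₂ + |(k : ℤ) - y.step|))
        (by simp [P.height_zero]; positivity)
        (by
          rw [P.height_eq_zero le_rfl]
          exact min_eq_left (by positivity))
        (fun k _ => le_min (P.height_nonneg k) (by positivity))
        (fun k hk => by
          obtain ⟨-, c, hc⟩ := P.height_le hk.le
          have h1 := P.height_step hk
          have h2 : ∃ e : ℤ, (y.step : ℤ) = y.y₂ + 2 * e :=
            ⟨y.y₁ + 1, by unfold Tri.step; push_cast; ring⟩
          obtain ⟨e, he⟩ := h2
          rw [abs_eq (by norm_num)]
          push_cast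
          rcases abs_cases ((k : ℤ) - y.step) with h3 | h3 <;>
          rcases abs_cases ((k : ℤ) + 1 - y.step) with h4 | h4 <;>
          omega)
      refine ⟨Q, fun z => ?_⟩
      have hz := z.sum_eq
      rw [hQ _ (by unfold Tri.step; omega), min_le_iff, hP]
      simp only [Set.exists_mem_insert, Tri.le_iff_step (y := y)]
      rw [or_comm]
      exact or_congr ⟨fun h => by omega, fun h => by omega⟩ Iff.rfl
  obtain ⟨P, hP⟩ := key U
  refine ⟨P, ?_⟩
  ext z
  exact (hP z).trans ⟨fun ⟨x, hx, hxz⟩ => U.upper hxz hx, fun hz => ⟨z, hz, le_rfl⟩⟩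

end DyckPath

/-- The Stanley lattice is the lattice of upper sets of the triangle. -/
noncomputable def stanleyIsoUpperSet (n : ℕ) : (stanleyLE : DyckPath n → DyckPath n → Prop) ≃r
    ((· ≤ ·) : UpperSet (Tri n) → UpperSet (Tri n) → Prop) where
  toEquiv := Equiv.ofBijective DyckPath.upperSet
    ⟨fun _ _ h => DyckPath.ext_height fun k =>
      le_antisymm (DyckPath.stanleyLE_iff.2 h.le k) (DyckPath.stanleyLE_iff.2 h.ge k),
    DyckPath.exists_upperSet_eq⟩
  map_rel_iff' := DyckPath.stanleyLE_iff.symm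

/-- The maxima of the classes of the catalan congruences correspond to the antichains contained in
a wall. -/
theorem exists_isWall_iff_isCatalanMax {n : ℕ} {A : ASM n} :
    (∃ W : Set (Tetra n), IsWall W ∧ meetAntichain A ⊆ W) ↔ IsCatalanMax A := by
  constructor
  · rintro ⟨W, ⟨g⟩, hW⟩
    obtain ⟨ψ⟩ := restrictCon_quotient (asmIsoUpperSet n) g
    exact ⟨restrictCon (asmIsoUpperSet n) W, ⟨ψ.trans (stanleyIsoUpperSet n).symm⟩,
      restrictCon_isGreatest _ fun x hx => hW hx⟩
  · rintro ⟨c, ⟨ψ⟩, hA⟩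
    obtain ⟨W, hW, h⟩ := exists_subset_of_congruence (asmIsoUpperSet n) c
      (ψ.trans (stanleyIsoUpperSet n)) hA
    exact ⟨W, hW, fun x hx => h x hx⟩

/-! ### Projected depths -/

theorem Tetra.ext_proj {n : ℕ} {x x' : Tetra n} (h : x.proj = x'.proj) (hd : x.depth = x'.depth) :
    x = x' := by
  have h1 : x.x₁ = x'.x₁ := congrArg Tri.y₁ h
  have h2 : x.x₂ + x.x₃ = x'.x₂ + x'.x₃ := congrArg Tri.y₂ h
  have h3 : x.x₄ = x'.x₄ := congrArg Tri.y₃ h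
  unfold Tetra.depth at hd
  ext <;> omega

theorem Tetra.le_iff_proj {n : ℕ} {x x' : Tetra n} :
    x ≤ x' ↔ x.proj ≤ x'.proj ∧ |x.depth - x'.depth| ≤ (x'.proj.y₂ : ℤ) - x.proj.y₂ := by
  change (x'.x₁ ≤ x.x₁ ∧ x.x₂ ≤ x'.x₂ ∧ x.x₃ ≤ x'.x₃ ∧ x'.x₄ ≤ x.x₄) ↔ _
  rw [Tri.le_iff, abs_le]
  have := x.sum_eq
  have := x'.sum_eq
  simp only [Tetra.proj, Tetra.depth]
  omega

theorem Tetra.exists_of_depth {n : ℕ} {y : Tri n} {d : ℤ} (h1 : -(y.y₂ : ℤ) ≤ d)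
    (h2 : d ≤ (y.y₂ : ℤ)) (h3 : d ≡ (y.y₂ : ℤ) [ZMOD 2]) :
    ∃ x : Tetra n, x.proj = y ∧ x.depth = d := by
  have := y.sum_eq
  unfold Int.ModEq at h3
  refine ⟨⟨y.y₁, ((y.y₂ - d) / 2).toNat, ((y.y₂ + d) / 2).toNat, y.y₃, by omega⟩, ?_, ?_⟩
  · ext <;> simp only [Tetra.proj]
    omega
  · simp only [Tetra.depth]
    omega

theorem eq_of_le_of_mem_meetAntichain {n : ℕ} {A : ASM n} {x y : Tetra n}
    (hx : x ∈ meetAntichain A) (hy : y ∈ meetAntichain A) (h : x ≤ y) : x = y :=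
  hy.eq_of_le hx.1 h

/-- Without crossings, two points of `m(A)` have incomparable projections, and their depths differ
at most as much as their positions. -/
theorem NoCrossing.eq_or {n : ℕ} {A : ASM n} (hA : NoCrossing A) {x y : Tetra n}
    (hx : x ∈ meetAntichain A) (hy : y ∈ meetAntichain A) :
    x = y ∨ (¬ x.proj ≤ y.proj ∧ |x.depth - y.depth| ≤
      |(x.proj.y₁ : ℤ) - y.proj.y₁| + |(x.proj.y₃ : ℤ) - y.proj.y₃|) := by
  by_cases hxy : x = y
  · exact Or.inl hxy
  right
  have h1 : ¬ x ≤ y := fun h => hxy (eq_of_le_of_mem_meetAntichain hx hy h)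
  have h2 : ¬ y ≤ x := fun h => hxy (eq_of_le_of_mem_meetAntichain hy hx h).symm
  have h3 := hA x hx y hy
  have h4 := hA y hy x hx
  have := x.sum_eq
  have := y.sum_eq
  change ¬ (y.x₁ ≤ x.x₁ ∧ x.x₂ ≤ y.x₂ ∧ x.x₃ ≤ y.x₃ ∧ y.x₄ ≤ x.x₄) at h1
  change ¬ (x.x₁ ≤ y.x₁ ∧ y.x₂ ≤ x.x₂ ∧ y.x₃ ≤ x.x₃ ∧ x.x₄ ≤ y.x₄) at h2
  rw [Tri.le_iff]
  simp only [Tetra.proj, Tetra.depth, Tetra.row, Tetra.column] at *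
  refine ⟨by omega, ?_⟩
  rcases abs_cases ((x.x₁ : ℤ) - y.x₁) with h5 | h5 <;>
  rcases abs_cases ((x.x₄ : ℤ) - y.x₄) with h6 | h6 <;>
  rw [abs_le] <;> omega

theorem NoCrossing.exists_isDepthAntichain {n : ℕ} {A : ASM n} (hA : NoCrossing A) :
    ∃ ε : projAntichain A → ℤ, IsProjectedDepth A ε ∧ IsDepthAntichain (projAntichain A) ε := by
  choose f hf hfp using fun y : projAntichain A => y.2
  have hmod : ∀ x : Tetra n, x.depth ≡ (x.proj.y₂ : ℤ) [ZMOD 2] := by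
    intro x
    simp only [Int.ModEq, Tetra.depth, Tetra.proj]
    omega
  refine ⟨fun y => (f y).depth, fun x hx => ?_, ?_, fun y => ?_, fun y z => ?_⟩
  · have hp := hfp ⟨x.proj, Set.mem_image_of_mem _ hx⟩
    rcases hA.eq_or (hf ⟨x.proj, Set.mem_image_of_mem _ hx⟩) hx with h | h
    · simp only [h]
    · exact absurd hp.le h.1
  · rintro _ ⟨x, hx, rfl⟩ _ ⟨y, hy, rfl⟩ hne hle
    rcases hA.eq_or hx hy with h | h
    · exact hne (congrArg _ h)
    · exact h.1 hle
  · rw [← hfp y]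
    refine ⟨?_, ?_, hmod _⟩ <;> simp only [Tetra.depth, Tetra.proj] <;> omega
  · rcases hA.eq_or (hf y) (hf z) with h | h
    · simp only [h, sub_self, abs_zero]
      positivity
    · rw [hfp, hfp] at h
      exact h.2

/-- For a crossing pair the depths differ by the sum of the row and column distances, which exceeds
the Lipschitz bound because the projections are incomparable. -/
theorem noCrossing_of_isDepthAntichain {n : ℕ} {A : ASM n} {ε : projAntichain A → ℤ}
    (h1 : IsProjectedDepth A ε) (h2 : IsDepthAntichain (projAntichain A) ε) : NoCrossing A := by
  rintro x hx y hy ⟨hr, hc⟩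
  have hne : x.proj ≠ y.proj := by
    intro h
    have hd : x.depth = y.depth := by
      rw [← h1 x hx, ← h1 y hy]
      exact congrArg ε (Subtype.ext h)
    rw [Tetra.ext_proj h hd] at hr
    exact lt_irrefl _ hr
  have h3 := h2.1 (Set.mem_image_of_mem _ hx) (Set.mem_image_of_mem _ hy) hne
  have h4 := h2.1 (Set.mem_image_of_mem _ hy) (Set.mem_image_of_mem _ hx) hne.symm
  have h5 := h2.2.2 ⟨_, Set.mem_image_of_mem _ hx⟩ ⟨_, Set.mem_image_of_mem _ hy⟩
  rw [h1 x hx, h1 y hy] at h5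
  change ¬ x.proj ≤ y.proj at h3
  change ¬ y.proj ≤ x.proj at h4
  rw [Tri.le_iff] at h3 h4
  have := x.sum_eq
  have := y.sum_eq
  simp only [Tetra.proj, Tetra.depth, Tetra.row, Tetra.column] at *
  rw [abs_le] at h5
  rcases abs_cases ((x.x₁ : ℤ) - y.x₁) with h6 | h6 <;>
  rcases abs_cases ((x.x₄ : ℤ) - y.x₄) with h7 | h7 <;>
  omega

/-! ### Depth triangles -/

namespace IsDepthTriangle

variable {n : ℕ} {δ : Tri n → ℤ}

theorem bounds (hδ : IsDepthTriangle δ) (y : Tri n) :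
    -(y.y₂ : ℤ) ≤ δ y ∧ δ y ≤ (y.y₂ : ℤ) ∧ δ y ≡ (y.y₂ : ℤ) [ZMOD 2] := by
  unfold Int.ModEq
  obtain ⟨k, hk⟩ : ∃ k, y.y₂ = k := ⟨_, rfl⟩
  induction k generalizing y with
  | zero =>
    rw [hδ.1 y hk, hk]
    simp
  | succ k ih =>
    have := y.sum_eq
    let z : Tri n := ⟨y.y₁, k, y.y₃ + 1, by omega⟩
    have h1 := hδ.2.1 y z rfl hk.symm rfl
    have h2 := ih z rfl
    simp only [show z.y₂ = k from rfl] at h2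
    rw [abs_eq (by norm_num)] at h1
    rw [hk]
    push_cast
    omega

theorem abs_sub_le_of_le (hδ : IsDepthTriangle δ) {y z : Tri n} (h : y ≤ z) :
    |δ y - δ z| ≤ (z.y₂ : ℤ) - y.y₂ := by
  obtain ⟨k, hk⟩ : ∃ k, z.y₂ - y.y₂ = k := ⟨_, rfl⟩
  have hy := y.sum_eq
  induction k generalizing z with
  | zero =>
    rw [Tri.le_iff] at h
    have hz := z.sum_eq
    have : y = z := by ext <;> omega
    simp [this]
  | succ k ih =>
    rw [Tri.le_iff] at h
    have hz := z.sum_eq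
    by_cases hlt : y.y₁ + y.y₂ < z.y₁ + z.y₂
    · let w : Tri n := ⟨z.y₁, z.y₂ - 1, z.y₃ + 1, by omega⟩
      have hw : w.y₂ = z.y₂ - 1 := rfl
      have h1 := hδ.2.1 z w rfl (by omega) rfl
      have h2 := ih (z := w) (by rw [Tri.le_iff]; simp only [w]; omega) (by omega)
      rw [abs_eq (by norm_num)] at h1
      rw [abs_le] at *
      omega
    · let w : Tri n := ⟨z.y₁ + 1, z.y₂ - 1, z.y₃, by omega⟩
      have hw : w.y₂ = z.y₂ - 1 := rfl
      have h1 := hδ.2.2 z w rfl (by omega) rfl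
      have h2 := ih (z := w) (by rw [Tri.le_iff]; simp only [w]; omega) (by omega)
      rw [abs_eq (by norm_num)] at h1
      rw [abs_le] at *
      omega

/-- The Lipschitz condition follows from the comparison of both points with their join. -/
theorem abs_sub_le (hδ : IsDepthTriangle δ) (y z : Tri n) :
    |δ y - δ z| ≤ |(y.y₁ : ℤ) - z.y₁| + |(y.y₃ : ℤ) - z.y₃| := by
  have hy := y.sum_eq
  have hz := z.sum_eq
  obtain ⟨w, hw1, hw3⟩ : ∃ w : Tri n, w.y₁ = min y.y₁ z.y₁ ∧ w.y₃ = min y.y₃ z.y₃ :=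
    ⟨⟨min y.y₁ z.y₁, n - 2 - min y.y₁ z.y₁ - min y.y₃ z.y₃, min y.y₃ z.y₃, by omega⟩, rfl, rfl⟩
  have hw := w.sum_eq
  have h1 := hδ.abs_sub_le_of_le (y := y) (z := w) (by rw [Tri.le_iff]; omega)
  have h2 := hδ.abs_sub_le_of_le (y := z) (z := w) (by rw [Tri.le_iff]; omega)
  rw [abs_le] at h1 h2 ⊢
  rcases abs_cases ((y.y₁ : ℤ) - z.y₁) with h6 | h6 <;>
  rcases abs_cases ((y.y₃ : ℤ) - z.y₃) with h7 | h7 <;>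
  omega

/-- The graph of a depth triangle is a wall. -/
theorem isWall (hδ : IsDepthTriangle δ) : IsWall {x : Tetra n | δ x.proj = x.depth} := by
  choose w hwp hwd using fun y => Tetra.exists_of_depth (hδ.bounds y).1 (hδ.bounds y).2.1
    (hδ.bounds y).2.2
  have hle : ∀ y z, w y ≤ w z ↔ y ≤ z := by
    intro y z
    rw [Tetra.le_iff_proj, hwp, hwp, hwd, hwd]
    exact ⟨fun h => h.1, fun h => ⟨h, hδ.abs_sub_le_of_le h⟩⟩
  have hrange : {x : Tetra n | δ x.proj = x.depth} = Set.range w := by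
    ext x
    constructor
    · intro hx
      exact ⟨x.proj, Tetra.ext_proj (hwp _) ((hwd _).trans hx)⟩
    · rintro ⟨y, rfl⟩
      rw [Set.mem_ofPred_eq, hwp, hwd]
  rw [hrange]
  exact ⟨(OrderEmbedding.ofMapLEIff w hle).orderIso.symm⟩

/-- If the points of `m(A)` lie on the graph of a depth triangle, comparable projections come from
comparable points, so they coincide. -/
theorem isDepthAntichain (hδ : IsDepthTriangle δ) {A : ASM n} {ε : projAntichain A → ℤ}
    (hε : IsProjectedDepth A ε) (h : ∀ y : projAntichain A, δ y.val = ε y) :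
    IsDepthAntichain (projAntichain A) ε := by
  refine ⟨?_, fun y => ?_, fun y z => ?_⟩
  · rintro _ ⟨x, hx, rfl⟩ _ ⟨y, hy, rfl⟩ hne hle
    have h1 := hδ.abs_sub_le_of_le hle
    rw [h ⟨_, Set.mem_image_of_mem _ hx⟩, h ⟨_, Set.mem_image_of_mem _ hy⟩, hε x hx, hε y hy]
      at h1
    exact hne (congrArg _ (eq_of_le_of_mem_meetAntichain hx hy (Tetra.le_iff_proj.2 ⟨hle, h1⟩)))
  · rw [← h]
    exact hδ.bounds y.val
  · rw [← h, ← h]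
    exact hδ.abs_sub_le y.val z.val

end IsDepthTriangle

/-- A depth antichain extends to a depth triangle: the least extension with the given Lipschitz
constant, bounded below by `-y₂`. -/
theorem IsDepthAntichain.exists_isDepthTriangle {n : ℕ} {S : Set (Tri n)} {ε : S → ℤ}
    (hε : IsDepthAntichain S ε) : ∃ δ : Tri n → ℤ, IsDepthTriangle δ ∧ ∀ y : S, δ y.val = ε y := by
  -- The value `none` stands for the lower bound `-y₂`, which forces the value `0` at `y₂ = 0`.
  let f : Tri n → Option S → ℤ := fun y o => o.elim (-(y.y₂ : ℤ)) fun z =>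
    ε z - (|(y.y₁ : ℤ) - z.val.y₁| + |(y.y₃ : ℤ) - z.val.y₃|)
  have hmod : ∀ y o, f y o ≡ (y.y₂ : ℤ) [ZMOD 2] := by
    intro y o
    cases o with
    | none =>
      simp only [f, Option.elim, Int.ModEq]
      omega
    | some z =>
      have h1 := (hε.2.1 z).2.2
      have := y.sum_eq
      have := z.val.sum_eq
      simp only [f, Option.elim, Int.ModEq] at *
      rcases abs_cases ((y.y₁ : ℤ) - z.val.y₁) with h6 | h6 <;>
      rcases abs_cases ((y.y₃ : ℤ) - z.val.y₃) with h7 | h7 <;>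
      omega
  have hbound : ∀ y o, f y o ≤ y.y₂ := by
    intro y o
    cases o with
    | none =>
      simp only [f, Option.elim]
      omega
    | some z =>
      have h1 := (hε.2.1 z).2.1
      have := y.sum_eq
      have := z.val.sum_eq
      simp only [f, Option.elim] at *
      rcases abs_cases ((y.y₁ : ℤ) - z.val.y₁) with h6 | h6 <;>
      rcases abs_cases ((y.y₃ : ℤ) - z.val.y₃) with h7 | h7 <;>
      omega
  choose o ho using fun y => Finite.exists_max (f y)
  have hstep : ∀ y z : Tri n, z.y₂ + 1 = y.y₂ →
      |(y.y₁ : ℤ) - z.y₁| + |(y.y₃ : ℤ) - z.y₃| = 1 → |f y (o y) - f z (o z)| = 1 := by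
    intro y z h1 h2
    have hlip : ∀ o, |f y o - f z o| ≤ 1 := by
      intro o
      cases o with
      | none =>
        simp only [f, Option.elim]
        rw [abs_le]
        omega
      | some w =>
        simp only [f, Option.elim]
        have t1 := _root_.abs_sub_le (y.y₁ : ℤ) z.y₁ w.val.y₁
        have t2 := _root_.abs_sub_le (z.y₁ : ℤ) y.y₁ w.val.y₁
        have t3 := _root_.abs_sub_le (y.y₃ : ℤ) z.y₃ w.val.y₃
        have t4 := _root_.abs_sub_le (z.y₃ : ℤ) y.y₃ w.val.y₃
        rw [abs_sub_comm (z.y₁ : ℤ) y.y₁] at t2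
        rw [abs_sub_comm (z.y₃ : ℤ) y.y₃] at t4
        rw [abs_le]
        omega
    have h3 := hlip (o y)
    have h4 := hlip (o z)
    have h5 := ho y (o z)
    have h6 := ho z (o y)
    have h7 := hmod y (o y)
    have h8 := hmod z (o z)
    rw [abs_le] at h3 h4
    rw [abs_eq (by norm_num)]
    unfold Int.ModEq at h7 h8
    omega
  refine ⟨fun y => f y (o y), ⟨fun y hy => ?_, fun y z h1 h2 h3 => hstep y z h2 ?_,
    fun y z h1 h2 h3 => hstep y z h2 ?_⟩, fun y => le_antisymm ?_ ?_⟩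
  · have h1 := hbound y (o y)
    have h2 := ho y none
    simp only [f, Option.elim, hy] at *
    omega
  · rw [h1, h3]; simp
  · rw [h1, h3]; simp
  · have hb := (hε.2.1 y).1
    have hl := fun z => hε.2.2 y z
    change f y.val (o y.val) ≤ ε y
    cases o y.val with
    | none => exact hb
    | some z =>
      have h1 := (abs_le.1 (hl z)).1
      simp only [f, Option.elim]
      omega
  · refine le_trans ?_ (ho y.val (some y))
    simp [f]

/-! ### Walls are graphs of depth triangles -/

theorem Tetra.eq_of_le_of_height {n : ℕ} {x y : Tetra n} (h : x ≤ y) (hh : x.height = y.height) :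
    x = y := by
  rw [Tetra.le_iff] at h
  rw [Tetra.ext_iff']
  have h1 := abs_nonneg ((x.row : ℤ) - y.row)
  have h2 := abs_nonneg ((x.column : ℤ) - y.column)
  have h3 := abs_eq_zero.1 (show |(x.row : ℤ) - y.row| = 0 by omega)
  have h4 := abs_eq_zero.1 (show |(x.column : ℤ) - y.column| = 0 by omega)
  omega

/-- An embedding of the triangle into the tetrahedron preserves the rank, because both posets are
graded of the same length. -/
theorem height_embedding {n : ℕ} (f : Tri n ↪o Tetra n) (y : Tri n) : (f y).height = y.y₂ := by
  have hlt : ∀ y z, y ≤ z → y ≠ z → (f y).height < (f z).height := by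
    intro y z h hne
    have h1 : f y ≤ f z := f.monotone h
    refine lt_of_le_of_ne ?_ fun h2 => hne (f.injective (Tetra.eq_of_le_of_height h1 h2))
    rw [Tetra.le_iff] at h1
    have := abs_nonneg (((f y).row : ℤ) - (f z).row)
    have := abs_nonneg (((f y).column : ℤ) - (f z).column)
    omega
  refine le_antisymm ?_ ?_
  · obtain ⟨k, hk⟩ : ∃ k, y.y₁ + y.y₃ = k := ⟨_, rfl⟩
    induction k generalizing y with
    | zero =>
      have := y.sum_eq
      have := (f y).sum_eq
      unfold Tetra.height
      omega
    | succ k ih =>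
      have := y.sum_eq
      -- An upper cover of `y`.
      obtain ⟨z, h1, h2, h3⟩ : ∃ z : Tri n, y ≤ z ∧ z.y₁ + z.y₃ = k ∧ z.y₂ = y.y₂ + 1 := by
        by_cases h : y.y₁ = 0
        · exact ⟨⟨y.y₁, y.y₂ + 1, y.y₃ - 1, by omega⟩, by rw [Tri.le_iff]; simp only; omega,
            by simp only; omega, rfl⟩
        · exact ⟨⟨y.y₁ - 1, y.y₂ + 1, y.y₃, by omega⟩, by rw [Tri.le_iff]; simp only; omega,
            by simp only; omega, rfl⟩
      have h4 := ih z h2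
      have h5 := hlt y z h1 (by rintro rfl; omega)
      omega
  · obtain ⟨k, hk⟩ : ∃ k, y.y₂ = k := ⟨_, rfl⟩
    induction k generalizing y with
    | zero => omega
    | succ k ih =>
      have := y.sum_eq
      let z : Tri n := ⟨y.y₁, k, y.y₃ + 1, by omega⟩
      have h4 := ih z rfl
      have h5 := hlt z y (by rw [Tri.le_iff]; simp only [z]; omega)
        (by intro h; have := congrArg Tri.y₂ h; simp only [z] at this; omega)
      simp only [z] at h4 h5
      omega

/-- A sequence with steps `±1` that never turns back is monotone or antitone. -/
theorem eq_add_or_eq_sub {g : ℕ → ℤ} {N : ℕ} (h1 : ∀ k < N, g (k + 1) = g k + 1 ∨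
    g (k + 1) = g k - 1) (h2 : ∀ k, k + 2 ≤ N → g (k + 2) ≠ g k) :
    (∀ k ≤ N, g k = g 0 + k) ∨ (∀ k ≤ N, g k = g 0 - k) := by
  by_cases h : N = 0
  · left
    intro k hk
    have : k = 0 := by omega
    simp [this]
  rcases h1 0 (by omega) with h0 | h0
  · left
    have hs : ∀ k < N, g (k + 1) = g k + 1 := by
      intro k hk
      induction k with
      | zero => exact h0
      | succ k ih =>
        have := ih (by omega)
        have := h1 (k + 1) hk
        have : g (k + 1 + 1) ≠ g k := h2 k hk
        omega
    intro k hk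
    induction k with
    | zero => simp
    | succ k ih =>
      rw [hs k hk, ih (by omega)]
      push_cast
      ring
  · right
    have hs : ∀ k < N, g (k + 1) = g k - 1 := by
      intro k hk
      induction k with
      | zero => exact h0
      | succ k ih =>
        have := ih (by omega)
        have := h1 (k + 1) hk
        have : g (k + 1 + 1) ≠ g k := h2 k hk
        omega
    intro k hk
    induction k with
    | zero => simp
    | succ k ih =>
      rw [hs k hk, ih (by omega)]
      push_cast
      ring

/-- The reflection of the triangle that exchanges `y₁` and `y₃`. -/
def Tri.reflect {n : ℕ} (y : Tri n) : Tri n := ⟨y.y₃, y.y₂, y.y₁, by have := y.sum_eq; omega⟩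

/-- Up to a reflection, an embedding of the triangle into the tetrahedron is a section of the
projection. It permutes the minimal elements, and minimal elements with a common upper cover stay
neighbours; so their order is kept or reversed, and this determines all other projections. -/
theorem proj_embedding {n : ℕ} (f : Tri n ↪o Tetra n) :
    (∀ y, (f y).proj = y) ∨ (∀ y, (f y).proj = y.reflect) := by
  by_cases hn : n < 2
  · left
    intro y
    have := y.sum_eq
    omega
  obtain ⟨N, rfl⟩ : ∃ N, n = N + 2 := ⟨n - 2, by omega⟩
  have hh := height_embedding f
  unfold Tetra.height at hh
  -- The minimal elements of the triangle (with an irrelevant value at `k > N`).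
  let b : ℕ → Tri (N + 2) := fun k =>
    if hk : k ≤ N then ⟨k, 0, N - k, by omega⟩ else ⟨0, 0, N, by omega⟩
  have hb : ∀ k ≤ N, (b k).y₁ = k ∧ (b k).y₂ = 0 ∧ (b k).y₃ = N - k := by
    intro k hk
    simp only [b, dif_pos hk, and_self]
  have hle : ∀ k ≤ N, ∀ y, y.y₁ ≤ k → k ≤ y.y₁ + y.y₂ →
      (f y).x₁ ≤ (f (b k)).x₁ ∧ (f (b k)).x₁ + (f y).x₄ ≤ N := by
    intro k hk y h1 h2
    obtain ⟨hb1, hb2, hb3⟩ := hb k hk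
    have hy := y.sum_eq
    have h3 : f (b k) ≤ f y := f.monotone (by rw [Tri.le_iff]; omega)
    have h4 : (f y).x₁ ≤ (f (b k)).x₁ := h3.1
    have h5 : (f y).x₄ ≤ (f (b k)).x₄ := h3.2.2.2
    have h6 := (f (b k)).sum_eq
    have h7 := hh (b k)
    omega
  have hinj : ∀ k l, k ≤ N → l ≤ N → k ≠ l → (f (b k)).x₁ ≠ (f (b l)).x₁ := by
    intro k l hk hl hkl h
    have e1 := (f (b k)).sum_eq
    have e2 := (f (b l)).sum_eq
    have e3 := hh (b k)
    have e4 := hh (b l)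
    have e5 := hb k hk
    have e6 := hb l hl
    have : f (b k) = f (b l) := by ext <;> omega
    have := congrArg Tri.y₁ (f.injective this)
    omega
  have hkey := eq_add_or_eq_sub (g := fun k => ((f (b k)).x₁ : ℤ)) (N := N)
    (fun k hk => by
      -- The common upper cover of two neighbours.
      let y : Tri (N + 2) := ⟨k, 1, N - k - 1, by omega⟩
      have h1 := hle k hk.le y (by simp [y]) (by simp [y])
      have h2 := hle (k + 1) hk y (by simp [y]) (by simp [y])
      have h3 := hinj k (k + 1) hk.le hk (by omega)
      have h4 := (f y).sum_eq
      have h5 := hh y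
      simp only [show y.y₂ = 1 from rfl] at h5
      omega)
    (fun k hk h => hinj (k + 2) k hk (by omega) (by omega) (by exact_mod_cast h))
  have hrange : ∀ k ≤ N, (f (b k)).x₁ ≤ N := by
    intro k hk
    have := (f (b k)).sum_eq
    omega
  rcases hkey with h | h
  · left
    have hid : ∀ k ≤ N, (f (b k)).x₁ = k := by
      intro k hk
      have h1 := h k hk
      have h2 := h N le_rfl
      have h3 := hrange N le_rfl
      omega
    intro y
    have hy := y.sum_eq
    have h1 := hle y.y₁ (by omega) y le_rfl (by omega)
    have h2 := hle (y.y₁ + y.y₂) (by omega) y (by omega) le_rfl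
    rw [hid _ (by omega)] at h1 h2
    have h3 := (f y).sum_eq
    have h4 := hh y
    ext <;> simp only [Tetra.proj] <;> omega
  · right
    have hid : ∀ k ≤ N, (f (b k)).x₁ = N - k := by
      intro k hk
      have h1 := h k hk
      have h2 := h N le_rfl
      have h3 := hrange 0 (Nat.zero_le _)
      omega
    intro y
    have hy := y.sum_eq
    have h1 := hle y.y₁ (by omega) y le_rfl (by omega)
    have h2 := hle (y.y₁ + y.y₂) (by omega) y (by omega) le_rfl
    rw [hid _ (by omega)] at h1 h2
    have h3 := (f y).sum_eq
    have h4 := hh y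
    ext <;> simp only [Tetra.proj, Tri.reflect] <;> omega

/-- The depth along a section of the projection is a depth triangle: it changes by at most `1` along
a cover, and its parity is that of `y₂`. -/
theorem isDepthTriangle_of_section {n : ℕ} {f : Tri n → Tetra n} (hf : Monotone f)
    (hp : ∀ y, (f y).proj = y) : IsDepthTriangle fun y => (f y).depth := by
  have h2 : ∀ y, (f y).x₂ + (f y).x₃ = y.y₂ := fun y => congrArg Tri.y₂ (hp y)
  have hstep : ∀ y z : Tri n, z ≤ y → z.y₂ + 1 = y.y₂ → |(f y).depth - (f z).depth| = 1 := by
    intro y z hle h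
    obtain ⟨-, h3, h4, -⟩ := hf hle
    have := h2 y
    have := h2 z
    rw [abs_eq (by norm_num)]
    unfold Tetra.depth
    omega
  refine ⟨fun y hy => ?_, fun y z h1 h2 h3 => hstep y z (by rw [Tri.le_iff]; omega) h2,
    fun y z h1 h2 h3 => hstep y z (by rw [Tri.le_iff]; omega) h2⟩
  have := h2 y
  simp only [Tetra.depth]
  omega

theorem IsWall.exists_isDepthTriangle {n : ℕ} {W : Set (Tetra n)} (hW : IsWall W) :
    ∃ δ : Tri n → ℤ, IsDepthTriangle δ ∧ ∀ x ∈ W, δ x.proj = x.depth := by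
  obtain ⟨g⟩ := hW
  let f : Tri n ↪o Tetra n := g.symm.toOrderEmbedding.trans (OrderEmbedding.subtype _)
  have hfg : ∀ x : W, f (g x) = x.val := fun x => congrArg Subtype.val (g.symm_apply_apply x)
  rcases proj_embedding f with h | h
  · refine ⟨_, isDepthTriangle_of_section f.monotone h, fun x hx => ?_⟩
    have h1 := h (g ⟨x, hx⟩)
    rw [hfg] at h1
    rw [h1, hfg]
  · refine ⟨_, isDepthTriangle_of_section (f := fun y => f y.reflect)
      (fun y z hyz => f.monotone ?_) (fun y => h y.reflect), fun x hx => ?_⟩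
    · rw [Tri.le_iff] at *
      simp only [Tri.reflect]
      omega
    · have h1 := h (g ⟨x, hx⟩)
      rw [hfg] at h1
      simp only [h1]
      exact congrArg Tetra.depth (hfg ⟨x, hx⟩)

/-! ### The bijection with depth antichains -/

theorem meetAntichain_injective {n : ℕ} : Function.Injective (meetAntichain (n := n)) := by
  have key : ∀ A B : ASM n, meetAntichain A = meetAntichain B → A ≤ B := by
    intro A B h
    rw [le_iff_upperOf_subset]
    intro x hx
    obtain ⟨y, hy, hyx⟩ := exists_meetAntichain_le hx
    exact isUpperSet_upperOf A hyx (h ▸ hy).1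
  exact fun A B h => le_antisymm (key A B h) (key B A h.symm)

theorem isGLB_meetAntichain {n : ℕ} (A : ASM n) : IsGLB (meetIrr '' meetAntichain A) A := by
  constructor
  · rintro _ ⟨x, hx, rfl⟩
    exact hx.1
  · intro B hB
    rw [le_iff_upperOf_subset]
    intro x hx
    obtain ⟨y, hy, hyx⟩ := exists_meetAntichain_le hx
    exact isUpperSet_upperOf B hyx (hB (Set.mem_image_of_mem _ hy))

theorem exists_meetAntichain_eq {n : ℕ} {X : Set (Tetra n)} (hX : IsAntichain (· ≤ ·) X) :
    ∃ A : ASM n, meetAntichain A = X := by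
  obtain ⟨A, hA⟩ := exists_upperOf_eq (upperClosure X)
  refine ⟨A, ?_⟩
  have h : meetAntichain A = {x | Minimal (· ∈ upperClosure X) x} := by
    unfold meetAntichain
    rw [hA]
    rfl
  rw [h]
  exact Set.ext fun _ => hX.minimal_mem_upperClosure_iff_mem

namespace DepthAntichain

variable {n : ℕ}

/-- The lift of a depth antichain to the tetrahedron. -/
def lift (ε : DepthAntichain n) : Set (Tetra n) :=
  {x | ∃ hx : x.proj ∈ ε.carrier, ε.toFun ⟨x.proj, hx⟩ = x.depth}

theorem ext_of_forall {ε ε' : DepthAntichain n} (h : ε.carrier = ε'.carrier)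
    (h' : ∀ y hy hy', ε.toFun ⟨y, hy⟩ = ε'.toFun ⟨y, hy'⟩) : ε = ε' := by
  obtain ⟨S, f, hf⟩ := ε
  obtain ⟨S', f', hf'⟩ := ε'
  obtain rfl : S = S' := h
  obtain rfl : f = f' := funext fun y => h' y.val y.2 y.2
  rfl

theorem proj_image_lift (ε : DepthAntichain n) : Tetra.proj '' ε.lift = ε.carrier := by
  ext y
  constructor
  · rintro ⟨x, ⟨hx, -⟩, rfl⟩
    exact hx
  · intro hy
    obtain ⟨h1, h2, h3⟩ := ε.isDepthAntichain.2.1 ⟨y, hy⟩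
    obtain ⟨x, rfl, hx⟩ := Tetra.exists_of_depth h1 h2 h3
    exact ⟨x, ⟨hy, hx.symm⟩, rfl⟩

theorem isAntichain_lift (ε : DepthAntichain n) : IsAntichain (· ≤ ·) ε.lift := by
  rintro x ⟨hx, hxd⟩ y ⟨hy, hyd⟩ hne hle
  have h := ε.isDepthAntichain.1.eq hx hy (Tetra.le_iff_proj.1 hle).1
  refine hne (Tetra.ext_proj h ?_)
  rw [← hxd, ← hyd]
  exact congrArg _ (Subtype.ext h)

theorem lift_injective : Function.Injective (lift (n := n)) := by
  intro ε ε' h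
  have hc : ε.carrier = ε'.carrier := by rw [← proj_image_lift, h, proj_image_lift]
  refine ext_of_forall hc fun y hy hy' => ?_
  obtain ⟨x, hx, rfl⟩ := ε.proj_image_lift.ge hy
  have hx' : x ∈ ε'.lift := h ▸ hx
  obtain ⟨_, h1⟩ := hx
  obtain ⟨_, h2⟩ := hx'
  rw [h1, h2]

/-- The lifts of depth antichains are the antichains `m(A)` whose projected depth is a depth
antichain. -/
theorem exists_lift_eq_iff {A : ASM n} : (∃ ε : DepthAntichain n, ε.lift = meetAntichain A) ↔
    ∃ ε : projAntichain A → ℤ, IsProjectedDepth A ε ∧ IsDepthAntichain (projAntichain A) ε := by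
  constructor
  · rintro ⟨⟨S, f, hf⟩, h⟩
    obtain rfl : S = projAntichain A := by
      rw [projAntichain, ← h, proj_image_lift]
    refine ⟨f, fun x hx => ?_, hf⟩
    rw [← h] at hx
    exact hx.2
  · rintro ⟨f, h1, h2⟩
    refine ⟨⟨_, f, h2⟩, ?_⟩
    ext x
    constructor
    · rintro ⟨⟨y, hy, hyx⟩, hd⟩
      have hd' : y.depth = x.depth := by
        rw [← h1 y hy, ← hd]
        exact congrArg f (Subtype.ext hyx)
      rwa [← Tetra.ext_proj hyx hd']
    · intro hx
      exact ⟨Set.mem_image_of_mem _ hx, h1 x hx⟩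

end DepthAntichain

/-- The absence of crossings is the common reformulation of all conditions on `A` that involve its
minimal points only. -/
theorem tfae_noCrossing {n : ℕ} (A : ASM n) : List.TFAE
    [ NoCrossing A,
      ∃ ε : projAntichain A → ℤ, IsProjectedDepth A ε ∧ IsDepthAntichain (projAntichain A) ε,
      ∃ ε : projAntichain A → ℤ, IsProjectedDepth A ε ∧
        ∃ δ : Tri n → ℤ, IsDepthTriangle δ ∧ ∀ y : projAntichain A, δ y.val = ε y,
      ∃ W : Set (Tetra n), IsWall W ∧ meetAntichain A ⊆ W,
      IsCatalanMax A ] := by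
  tfae_have 1 → 2 := NoCrossing.exists_isDepthAntichain
  tfae_have 2 → 1 := fun ⟨_, h1, h2⟩ => noCrossing_of_isDepthAntichain h1 h2
  tfae_have 2 → 3 := fun ⟨ε, h1, h2⟩ => ⟨ε, h1, h2.exists_isDepthTriangle⟩
  tfae_have 3 → 2 := fun ⟨ε, h1, _, h2, h3⟩ => ⟨ε, h1, h2.isDepthAntichain h1 h3⟩
  tfae_have 3 → 4 := fun ⟨_, h1, _, h2, h3⟩ =>
    ⟨_, h2.isWall, fun x hx => (h3 ⟨_, Set.mem_image_of_mem _ hx⟩).trans (h1 x hx)⟩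
  tfae_have 4 → 3 := fun ⟨_, h1, h2⟩ => by
    obtain ⟨δ, hδ, h3⟩ := h1.exists_isDepthTriangle
    exact ⟨fun y => δ y.val, fun x hx => h3 x (h2 hx), δ, hδ, fun _ => rfl⟩
  tfae_have 4 ↔ 5 := exists_isWall_iff_isCatalanMax
  tfae_finish

end AlternatingSign

open AlternatingSign
theorem mainTheorem2 (n : ℕ) (hn : 1 ≤ n) :
    (∀ A : ASM n, List.TFAE
      [ ∃ σ : Equiv.Perm (Fin n), IsCovexillary σ ∧ A = permASM σ,
        ¬ ∃ i j k l : Fin (n + 1), IsAscent A i j ∧ IsAscent A k l ∧ i < k ∧ l < j,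
        ∃ ε : projAntichain A → ℤ, IsProjectedDepth A ε ∧ IsDepthAntichain (projAntichain A) ε,
        ∃ ε : projAntichain A → ℤ, IsProjectedDepth A ε ∧
          ∃ δ : Tri n → ℤ, IsDepthTriangle δ ∧ ∀ y : projAntichain A, δ y.val = ε y,
        ∃ W : Set (Tetra n), IsWall W ∧ meetAntichain A ⊆ W,
        ∃ c : LatticeCon (ASM n), IsCatalan c ∧ IsGreatest {B | c.r A B} A ]) ∧
    (∃ e : {σ : Equiv.Perm (Fin n) // IsCovexillary σ} ≃ {A : ASM n // IsCatalanMax A},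
      ∀ σ, (e σ).val = permASM σ.val) ∧
    (∃ e : DepthAntichain n ≃ {A : ASM n // IsCatalanMax A}, ∀ ε : DepthAntichain n,
      IsGLB {B : ASM n | ∃ x : Tetra n, ∃ hx : x.proj ∈ ε.carrier,
        ε.toFun ⟨x.proj, hx⟩ = x.depth ∧ B = meetIrr x} (e ε).val ∧
      ε.carrier = projAntichain (e ε).val ∧
      ∀ x ∈ meetAntichain (e ε).val, ∀ hx : x.proj ∈ ε.carrier,
        ε.toFun ⟨x.proj, hx⟩ = x.depth) := by
  have hmax : ∀ {A : ASM n}, NoCrossing A ↔ IsCatalanMax A := fun {A} =>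
    (tfae_noCrossing A).out 0 4
  refine ⟨fun A => ?_, ?_, ?_⟩
  · have h := tfae_noCrossing A
    tfae_have 1 ↔ 2 := exists_isCovexillary_iff.trans noCrossing_iff
    tfae_have 2 ↔ 3 := noCrossing_iff.symm.trans (h.out 0 1)
    tfae_have 3 ↔ 4 := h.out 1 2
    tfae_have 4 ↔ 5 := h.out 2 3
    tfae_have 5 ↔ 6 := h.out 3 4
    tfae_finish
  · refine ⟨Equiv.ofBijective (fun σ => ⟨permASM σ.val, hmax.1 σ.2.noCrossing⟩) ⟨?_, ?_⟩,
      fun _ => rfl⟩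
    · intro σ τ h
      exact Subtype.ext (permASM_injective (congrArg Subtype.val h))
    · rintro ⟨A, hA⟩
      obtain ⟨σ, hσ, rfl⟩ := exists_isCovexillary_iff.2 (hmax.2 hA)
      exact ⟨⟨σ, hσ⟩, rfl⟩
  · choose F hF using fun ε : DepthAntichain n => exists_meetAntichain_eq ε.isAntichain_lift
    have hlift : ∀ {A : ASM n}, (∃ ε : DepthAntichain n, ε.lift = meetAntichain A) ↔
        IsCatalanMax A := fun {A} =>
      DepthAntichain.exists_lift_eq_iff.trans ((tfae_noCrossing A).out 1 4)
    refine ⟨Equiv.ofBijective (fun ε => ⟨F ε, hlift.1 ⟨ε, (hF ε).symm⟩⟩) ⟨?_, ?_⟩, fun ε => ?_⟩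
    · intro ε ε' h
      have h' : F ε = F ε' := congrArg Subtype.val h
      exact DepthAntichain.lift_injective (by rw [← hF, h', hF])
    · rintro ⟨A, hA⟩
      obtain ⟨ε, hε⟩ := hlift.2 hA
      exact ⟨ε, Subtype.ext (meetAntichain_injective ((hF ε).trans hε))⟩
    · change IsGLB _ (F ε) ∧ ε.carrier = projAntichain (F ε) ∧ ∀ x ∈ meetAntichain (F ε), _
      refine ⟨?_, ?_, fun x hx _ => ?_⟩
      · convert isGLB_meetAntichain (F ε) using 1
        rw [hF]
        ext B
        constructor
        · rintro ⟨x, hx, hd, rfl⟩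
          exact ⟨x, ⟨hx, hd⟩, rfl⟩
        · rintro ⟨x, ⟨hx, hd⟩, rfl⟩
          exact ⟨x, hx, hd, rfl⟩
      · rw [projAntichain, hF, ε.proj_image_lift]
      · rw [hF] at hx
        exact hx.2
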